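/- **Setting.** Let $(M,g)$ be a smooth pseudo-Riemannian manifold of dimension $n$ and signature $\varepsilon=(\varepsilon_1,\dots,\varepsilon_n)\in\{\pm1\}^n$ with a spin structure, i.e. a lift of the orthonormal frames of $M$ to a principal bundle for the group $\mathrm{Spin}$ of those products $h$ of an even number of invertible vectors in the Clifford algebra (with $vw+wv=-2g(v,w)$) for which $h^{-1}$ is the reversed product. Let $S$ be the associated spinor bundle over $\mathbb K=\mathbb C$ (or $\mathbb K=\mathbb R$ in the case of real spinors), of rank $2^{\lfloor n/2\rfloor}$, with Clifford multiplication $\gamma(X)\xi=X\xi$, $XY+YX=-2g(X,Y)$. Let $\nabla$ be the Levi-Civita connection on $M$ and on $S$. Let $C$ be a charge conjugation on $S$: the parallel nondegenerate bilinear form induced by a form on the spinor module with $C(\varphi,\psi)=\Delta_0\,C(\psi,\varphi)$ and $C(\varphi,X\psi)=\Delta_1\,C(\psi,X\varphi)$, where $\Delta_0,\Delta_1\in\{\pm1\}$. For $k\in\mathbb Z$ put $\Delta_k=(-1)^{k(k-1)/2}\Delta_0^{k+1}\Delta_1^k$. An endomorphism $\Phi$ of $S$ has the charge adjoint $\Phi^C$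 given by $C(\Phi^C\eta,\xi)=C(\eta,\Phi\xi)$. Let $D=\nabla+\mathcal A$ be a connection on $S$, where $\mathcal A$ is a one-form with values in the $\mathbb K$-linear endomorphisms of $S$, and put $D^C=\nabla-\mathcal A^C$ and $$(\hat D_Z\gamma)(X)\xi=D_Z(X\xi)-(\nabla_ZX)\xi-X\,D^C_Z\xi .$$ The connection $D$ is called *admissible* if $\hat D\gamma$ is skew symmetric, i.e. $(\hat D_Z\gamma)(X)=-(\hat D_X\gamma)(Z)$ for all vector fields $X,Z$. A $\mathbb K$-valued $\ell$-form $\omega$ acts on $S$ by $\frac1{\ell!}\,\omega_{\mu_1\dots\mu_\ell}\gamma^{\mu_1}\cdots\gamma^{\mu_\ell}$; vectors and one-forms are identified by $g$. Let $\Omega^{(\ell,1)}$ be the space of those $\mathcal A_0\in\Omega^1\otimes\Omega^\ell$ whose total skew symmetrization and whose metric trace $\sum_a\varepsilon_a\,e_a\rfloor\mathcal A_0(e_a)$ vanish ($e$ an orthonormal frame with $g(e_a,e_b)=\varepsilon_a\delta_{ab}$). Forms are sections without any regularity assumption, and there are no nonzero forms of degree $-1$. **Theorem.** Suppose that $\mathcal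 A$ is homogeneous of degree $\ell$, $0\le\ell\le n$: every $\mathcal A_X$ is given by the action of an $\ell$-form. Then there are a unique $(\ell+1)$-form $F$, a unique $(\ell-1)$-form $G$ and a unique $\mathcal A_0\in\Omega^{(\ell,1)}$ such that, for all $X$, the endomorphism $\mathcal A_X$ is given by the $\ell$-form $$X\rfloor F+X\wedge G+\mathcal A_0(X).$$ The connection $D$ is admissible if and only if $\mathcal A_0=0$ and $\Delta_1\Delta_{\deg}=-1$ for the degree $\deg$ of each nonzero form among $F$ and $G$, that is: $$\mathcal A_0=0,\qquad F\neq0\Rightarrow\Delta_1\Delta_{\ell+1}=-1,\qquad G\neq0\Rightarrow\Delta_1\Delta_{\ell-1}=-1 .$$ Moreover, for every integer $\deg$, the following are equivalent: $\Delta_1\Delta_{\deg}=-1$; $\ \Delta_0\Delta_{\deg-1}=(-1)^{\deg}$; $\ \deg\equiv3$ or $\deg\equiv1+\Delta_0\Delta_1\pmod 4$. -/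

import Mathlib

open scoped Manifold ContDiff Bundle

noncomputable section

namespace SpinGeometry

/-! ### Signs and the model Clifford algebra -/

/-- The sign `Δ_k = (-1)^{k(k-1)/2} Δ₀^{k+1} Δ₁^k` of the bilinear map
`φ ⊗ ψ ↦ C(φ, γ_{μ₁…μ_k} ψ)`, for a charge conjugation `C` with `C(φ, ψ) = Δ₀ C(ψ, φ)` and
`C(φ, X ψ) = Δ₁ C(ψ, X φ)`. -/
def Delta (Δ₀ Δ₁ : ℤˣ) (k : ℤ) : ℤˣ := (-1) ^ (k * (k - 1) / 2) * Δ₀ ^ (k + 1) * Δ₁ ^ k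

/-- A sign as a real number. -/
def sgn (s : ℤˣ) : ℝ := ((s : ℤ) : ℝ)

/-- The standard scalar product `∑ ε_a v_a w_a` on `ℝⁿ` of signature `ε`. -/
def modelInner {n : ℕ} (ε : Fin n → ℤˣ) (v w : Fin n → ℝ) : ℝ := ∑ a, sgn (ε a) * v a * w a

/-- The quadratic form `v ↦ -∑ ε_a v_a²`.  Its Clifford algebra has the relations
`v w + w v = -2 ⟨v, w⟩`. -/
def cliffordForm {n : ℕ} (ε : Fin n → ℤˣ) : QuadraticForm ℝ (Fin n → ℝ) :=
  QuadraticMap.weightedSumSquares ℝ (fun a => -sgn (ε a))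

/-- A spinor module: a module `F` over `𝕜` (`= ℝ` or `ℂ`) for the Clifford algebra of the standard
scalar product of signature `ε` on `ℝⁿ`, of dimension `2^⌊n/2⌋`.  For `𝕜 = ℂ` these are the
irreducible complex modules (Dirac spinors), for `𝕜 = ℝ` these are the real forms of them. -/
structure SpinorModule (𝕜 : Type*) [RCLike 𝕜] (F : Type*) [NormedAddCommGroup F] [NormedSpace ℝ F]
    [NormedSpace 𝕜 F] [IsScalarTower ℝ 𝕜 F] {n : ℕ} (ε : Fin n → ℤˣ) where
  act : CliffordAlgebra (cliffordForm ε) →ₐ[ℝ] Module.End 𝕜 F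
  finrank_eq : Module.finrank 𝕜 F = 2 ^ (n / 2)

/-- A charge conjugation on a spinor module: a nondegenerate bilinear form, which is symmetric or
skew symmetric (`Δ₀ = ± 1`), and for which the same holds for `(φ, ψ) ↦ C(φ, v ψ)` (`Δ₁ = ± 1`). -/
structure ChargeConjugation {𝕜 : Type*} [RCLike 𝕜] {F : Type*} [NormedAddCommGroup F]
    [NormedSpace ℝ F] [NormedSpace 𝕜 F] [IsScalarTower ℝ 𝕜 F] {n : ℕ} {ε : Fin n → ℤˣ}
    (ρ : SpinorModule 𝕜 F ε) where
  form : LinearMap.BilinForm 𝕜 F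
  nondegenerate : form.Nondegenerate
  Δ₀ : ℤˣ
  Δ₁ : ℤˣ
  symm_zero : ∀ φ ψ : F, form φ ψ = (Δ₀ : ℤ) • form ψ φ
  symm_one : ∀ (v : Fin n → ℝ) (φ ψ : F),
    form φ (ρ.act (CliffordAlgebra.ι _ v) ψ) = (Δ₁ : ℤ) • form ψ (ρ.act (CliffordAlgebra.ι _ v) φ)

namespace ChargeConjugation

variable {𝕜 : Type*} [RCLike 𝕜] {F : Type*} [NormedAddCommGroup F]
    [NormedSpace ℝ F] [NormedSpace 𝕜 F] [IsScalarTower ℝ 𝕜 F] {n : ℕ} {ε : Fin n → ℤˣ}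
    {ρ : SpinorModule 𝕜 F ε} (C : ChargeConjugation ρ)

/-- The sign `Δ_k` of a charge conjugation. -/
def Δ (k : ℤ) : ℤˣ := Delta C.Δ₀ C.Δ₁ k

/-- Clifford multiplication by vectors is symmetric or skew symmetric for `C`. -/
theorem form_act_ι (v : Fin n → ℝ) (φ ψ : F) :
    C.form (ρ.act (CliffordAlgebra.ι _ v) φ) ψ =
      ((C.Δ₀ * C.Δ₁ : ℤˣ) : ℤ) • C.form φ (ρ.act (CliffordAlgebra.ι _ v) ψ) := by
  rw [C.symm_zero, C.symm_one v ψ φ, smul_smul]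
  simp

/-- The adjoint of the action of an even element. -/
theorem form_act_even (a : CliffordAlgebra (cliffordForm ε))
    (ha : a ∈ CliffordAlgebra.even (cliffordForm ε)) :
    ∀ φ ψ : F, C.form (ρ.act a φ) ψ = C.form φ (ρ.act (star a) ψ) := by
  have hs : ((C.Δ₀ * C.Δ₁ : ℤˣ) : ℤ) * ((C.Δ₀ * C.Δ₁ : ℤˣ) : ℤ) = 1 := by
    rcases Int.units_eq_one_or (C.Δ₀ * C.Δ₁) with h | h <;> simp [h]
  induction a, ha using CliffordAlgebra.even_induction with
  | algebraMap r =>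
    intro φ ψ
    have h1 : ∀ χ : F, ρ.act (algebraMap ℝ _ r) χ = (algebraMap ℝ 𝕜 r) • χ := by
      intro χ
      rw [AlgHom.commutes, Module.algebraMap_end_apply, algebraMap_smul]
    rw [CliffordAlgebra.star_algebraMap, h1, h1]
    simp
  | add x y _ _ hx hy => intro φ ψ; simp [hx φ ψ, hy φ ψ]
  | ι_mul_ι_mul v w x _ hx =>
    intro φ ψ
    simp only [star_mul, CliffordAlgebra.star_ι, map_mul, Module.End.mul_apply]
    rw [C.form_act_ι, C.form_act_ι, hx, smul_smul, hs, one_smul]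
    simp

/-- The charge conjugation is spin-invariant. -/
theorem form_spin {h : CliffordAlgebra (cliffordForm ε)} (hh : h ∈ spinGroup (cliffordForm ε))
    (φ ψ : F) : C.form (ρ.act h φ) (ρ.act h ψ) = C.form φ ψ := by
  rw [C.form_act_even h (spinGroup.mem_even hh), ← Module.End.mul_apply, ← map_mul,
    spinGroup.star_mul_self_of_mem hh]
  simp

end ChargeConjugation

/-! ### Pseudo-Riemannian metrics and the Levi-Civita connection -/

section Metric

variable (E : Type*) [NormedAddCommGroup E] [NormedSpace ℝ E]
  (M : Type*) [TopologicalSpace M] [ChartedSpace E M] [IsManifold 𝓘(ℝ, E) ∞ M]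

/-- A smooth pseudo-Riemannian metric on `M`. -/
structure PseudoRiemannianMetric where
  inner (x : M) : TangentSpace 𝓘(ℝ, E) x →L[ℝ] TangentSpace 𝓘(ℝ, E) x →L[ℝ] ℝ
  symm (x : M) (v w : TangentSpace 𝓘(ℝ, E) x) : inner x v w = inner x w v
  nondegenerate (x : M) (v : TangentSpace 𝓘(ℝ, E) x) (hv : ∀ w, inner x v w = 0) : v = 0
  contMDiff : ContMDiff 𝓘(ℝ, E) (𝓘(ℝ, E).prod 𝓘(ℝ, E →L[ℝ] E →L[ℝ] ℝ)) ∞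
    (fun x ↦ Bundle.TotalSpace.mk' (E →L[ℝ] E →L[ℝ] ℝ) x (inner x))

variable {E M}

/-- A connection on the tangent bundle is the Levi-Civita connection of `g` if it is metric,
`Z g(X, Y) = g(∇_Z X, Y) + g(X, ∇_Z Y)`, and torsion free, `∇_X Y - ∇_Y X = [X, Y]`. -/
structure IsLeviCivita (g : PseudoRiemannianMetric E M)
    (nabla : CovariantDerivative 𝓘(ℝ, E) E (TangentSpace 𝓘(ℝ, E) : M → Type _)) : Prop where
  metric : ∀ (x : M) (X Y : Π y : M, TangentSpace 𝓘(ℝ, E) y) (Z : TangentSpace 𝓘(ℝ, E) x),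
    MDiffAt (T% X) x → MDiffAt (T% Y) x →
      (mfderiv% (fun y => g.inner y (X y) (Y y)) x Z : ℝ) =
        g.inner x (nabla X x Z) (Y x) + g.inner x (X x) (nabla Y x Z)
  torsion_free : ∀ (x : M) (X Y : Π y : M, TangentSpace 𝓘(ℝ, E) y),
    MDiffAt (T% X) x → MDiffAt (T% Y) x →
      nabla Y x (X x) - nabla X x (Y x) = VectorField.mlieBracket 𝓘(ℝ, E) X Y x

end Metric

/-! ### Alternating forms -/

section Forms

variable {𝕜 : Type*} [RCLike 𝕜] {T : Type*} [AddCommGroup T] [Module ℝ T]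

/-- `X ∧ G`, where the vector `X` is identified with the one-form `B X` by the metric `B`, and `G`
is a form of degree `ℓ - 1`.  There are no forms of degree `-1`, so it is `0` for `ℓ = 0`. -/
def wedge (B : T →ₗ[ℝ] T →ₗ[ℝ] ℝ) :
    (ℓ : ℕ) → T → (T [⋀^Fin (ℓ - 1)]→ₗ[ℝ] 𝕜) → (T [⋀^Fin ℓ]→ₗ[ℝ] 𝕜)
  | 0, _, _ => 0
  | _ + 1, X, G => AlternatingMap.alternatizeUncurryFin ((B X).smulRight G)

/-- The metric trace `∑_a ε_a e_a ⌟ α(e_a)` of an element `α` of `T* ⊗ Λ^ℓ T*`, in terms of an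
orthonormal basis `e` with `g(e_a, e_b) = ε_a δ_ab`.  It does not depend on the basis. -/
def formTrace {n : ℕ} (ε : Fin n → ℤˣ) (e : Fin n → T) :
    (ℓ : ℕ) → (T →ₗ[ℝ] T [⋀^Fin ℓ]→ₗ[ℝ] 𝕜) → (T [⋀^Fin (ℓ - 1)]→ₗ[ℝ] 𝕜)
  | 0, _ => 0
  | _ + 1, α => ∑ a, sgn (ε a) • (α (e a)).curryLeft (e a)

/-- The endomorphism `(1/ℓ!) w_{μ₁…μ_ℓ} γ^{μ₁} ⋯ γ^{μ_ℓ}` given by an `ℓ`-form `w`, in terms of an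
orthonormal basis `e` with `g(e_a, e_b) = ε_a δ_ab` and of `γ_a`, the Clifford multiplication
by `e_a`.  It does not depend on the basis.  Since `w` is alternating, only the skew symmetrized
products `γ^{[μ₁} ⋯ γ^{μ_ℓ]}` enter. -/
def cliffordOfForm {S : Type*} [AddCommGroup S] [Module 𝕜 S] {n : ℕ} (ε : Fin n → ℤˣ)
    (e : Fin n → T) (γ : T → Module.End 𝕜 S) {ℓ : ℕ} (w : T [⋀^Fin ℓ]→ₗ[ℝ] 𝕜) : Module.End 𝕜 S :=
  ((ℓ.factorial : 𝕜)⁻¹) • ∑ I : Fin ℓ → Fin n,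
    (((∏ j, sgn (ε (I j)) : ℝ) : 𝕜) * w (fun j => e (I j))) •
      (List.ofFn fun j => γ (e (I j))).prod

end Forms

/-! ### Spin structures and spinor bundles -/

section Spin

variable {𝕜 : Type*} [RCLike 𝕜]
  {E : Type*} [NormedAddCommGroup E] [NormedSpace ℝ E]
  {M : Type*} [TopologicalSpace M] [ChartedSpace E M] [IsManifold 𝓘(ℝ, E) ∞ M]
  {F : Type*} [NormedAddCommGroup F] [NormedSpace ℝ F] [NormedSpace 𝕜 F] [IsScalarTower ℝ 𝕜 F]
  {n : ℕ} {ε : Fin n → ℤˣ}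

/-- A frame of `T_x M` together with a frame of the fibre `S_x` of a vector bundle. -/
abbrev FramePair (𝕜 : Type*) [RCLike 𝕜] {E : Type*} [NormedAddCommGroup E] [NormedSpace ℝ E]
    {M : Type*} [TopologicalSpace M] [ChartedSpace E M] (F : Type*) [NormedAddCommGroup F]
    [NormedSpace 𝕜 F] (n : ℕ) (S : M → Type*) [∀ x, AddCommGroup (S x)] [∀ x, Module 𝕜 (S x)]
    (x : M) :=
  ((Fin n → ℝ) ≃ₗ[ℝ] TangentSpace 𝓘(ℝ, E) x) × (F ≃ₗ[𝕜] S x)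

variable {S : M → Type*} [∀ x, AddCommGroup (S x)] [∀ x, Module 𝕜 (S x)]

/-- `q = p · h`: the frame pair `q = (e', θ')` arises from `p = (e, θ)` by the right action of the
element `h` of the spin group, i.e. `θ' = θ ∘ ρ(h)` and `e' = e ∘ λ(h)` with
`λ(h) v = h v h⁻¹` (where `h⁻¹ = star h`). -/
def SpinRelated (ρ : SpinorModule 𝕜 F ε) {x : M} (p : FramePair 𝕜 (E := E) F n S x)
    (h : CliffordAlgebra (cliffordForm ε)) (q : FramePair 𝕜 (E := E) F n S x) : Prop :=
  (∀ ψ, q.2 ψ = p.2 (ρ.act h ψ)) ∧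
    ∀ v, CliffordAlgebra.ι (cliffordForm ε) (p.1.symm (q.1 v)) =
      h * CliffordAlgebra.ι (cliffordForm ε) v * star h

variable [TopologicalSpace (Bundle.TotalSpace F S)]
  [∀ x, TopologicalSpace (S x)] [FiberBundle F S]

variable (S) in
/-- A spin structure on the pseudo-Riemannian manifold `(M, g)` with associated spinor
bundle `S`: a principal bundle `P` for the spin group, whose elements over `x` are given by the
orthonormal frames of `T_x M` and the frames of `S_x` which they define, on which the spin group
acts simply transitively and which has smooth local sections. -/
structure SpinStructure (g : PseudoRiemannianMetric E M) (ρ : SpinorModule 𝕜 F ε) where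
  P (x : M) : Set (FramePair 𝕜 (E := E) F n S x)
  orthonormal {x : M} {p : FramePair 𝕜 (E := E) F n S x} (hp : p ∈ P x) (v w : Fin n → ℝ) :
    g.inner x (p.1 v) (p.1 w) = modelInner ε v w
  mem_iff {x : M} {p : FramePair 𝕜 (E := E) F n S x} (hp : p ∈ P x)
    (q : FramePair 𝕜 (E := E) F n S x) :
    q ∈ P x ↔ ∃ h ∈ spinGroup (cliffordForm ε), SpinRelated ρ p h q
  exists_section (x : M) : ∃ U : Set M, IsOpen U ∧ x ∈ U ∧
    ∃ s : Π y : M, FramePair 𝕜 (E := E) F n S y, (∀ y ∈ U, s y ∈ P y) ∧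
      (∀ v, ContMDiffOn 𝓘(ℝ, E) (𝓘(ℝ, E).prod 𝓘(ℝ, E)) ∞
        (fun y => Bundle.TotalSpace.mk' E (E := (TangentSpace 𝓘(ℝ, E) : M → Type _)) y
          ((s y).1 v)) U) ∧
      (∀ ψ, ContMDiffOn 𝓘(ℝ, E) (𝓘(ℝ, E).prod 𝓘(ℝ, F)) ∞
        (fun y => Bundle.TotalSpace.mk' F (E := S) y ((s y).2 ψ)) U)

namespace SpinStructure

variable {g : PseudoRiemannianMetric E M} {ρ : SpinorModule 𝕜 F ε}
  (σ : SpinStructure (𝕜 := 𝕜) S g ρ)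

theorem nonempty (x : M) : (σ.P x).Nonempty := by
  obtain ⟨U, _, hx, s, hs, _⟩ := σ.exists_section x
  exact ⟨s x, hs x hx⟩

/-- A (chosen) element of the spin bundle over `x`. -/
def framePair (x : M) : FramePair 𝕜 (E := E) F n S x := (σ.nonempty x).choose

theorem framePair_mem (x : M) : σ.framePair x ∈ σ.P x := (σ.nonempty x).choose_spec

/-- The `a`-th vector of the chosen orthonormal frame of `T_x M`. -/
def e (x : M) (a : Fin n) : TangentSpace 𝓘(ℝ, E) x := (σ.framePair x).1 (Pi.single a 1)

/-- A local spin frame: a smooth local section of the spin bundle over an open set `U`. -/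
structure IsSpinFrame (U : Set M) (s : Π y : M, FramePair 𝕜 (E := E) F n S y) : Prop where
  isOpen : IsOpen U
  mem : ∀ y ∈ U, s y ∈ σ.P y
  contMDiffOn_fst : ∀ v, ContMDiffOn 𝓘(ℝ, E) (𝓘(ℝ, E).prod 𝓘(ℝ, E)) ∞
    (fun y => Bundle.TotalSpace.mk' E (E := (TangentSpace 𝓘(ℝ, E) : M → Type _)) y ((s y).1 v)) U
  contMDiffOn_snd : ∀ ψ, ContMDiffOn 𝓘(ℝ, E) (𝓘(ℝ, E).prod 𝓘(ℝ, F)) ∞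
    (fun y => Bundle.TotalSpace.mk' F (E := S) y ((s y).2 ψ)) U

/-- The Clifford multiplication `γ(X) : S_x → S_x` by a tangent vector `X ∈ T_x M`. -/
def gamma (x : M) : TangentSpace 𝓘(ℝ, E) x → Module.End 𝕜 (S x) := fun X =>
  (σ.framePair x).2.conj
    (ρ.act (CliffordAlgebra.ι (cliffordForm ε) ((σ.framePair x).1.symm X)))

/-- The Clifford multiplication can be computed in every spin frame. -/
theorem gamma_apply {x : M} {p : FramePair 𝕜 (E := E) F n S x} (hp : p ∈ σ.P x)
    (v : Fin n → ℝ) (ψ : F) :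
    σ.gamma x (p.1 v) (p.2 ψ) = p.2 (ρ.act (CliffordAlgebra.ι (cliffordForm ε) v) ψ) := by
  obtain ⟨h, hh, h2, h1⟩ := (σ.mem_iff (σ.framePair_mem x) p).1 hp
  rw [gamma, LinearEquiv.conj_apply_apply, h1, h2, LinearEquiv.symm_apply_apply, h2,
    ← Module.End.mul_apply, ← map_mul, mul_assoc, spinGroup.star_mul_self_of_mem hh, mul_one,
    map_mul, Module.End.mul_apply]

/-- The bilinear form on `S_x` given by a charge conjugation. -/
def form (C : ChargeConjugation ρ) (x : M) : LinearMap.BilinForm 𝕜 (S x) :=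
  LinearMap.BilinForm.congr (σ.framePair x).2 C.form

/-- The charge conjugation can be computed in every spin frame. -/
theorem form_apply (C : ChargeConjugation ρ) {x : M} {p : FramePair 𝕜 (E := E) F n S x}
    (hp : p ∈ σ.P x) (φ ψ : F) : σ.form C x (p.2 φ) (p.2 ψ) = C.form φ ψ := by
  obtain ⟨h, hh, h2, _⟩ := (σ.mem_iff (σ.framePair_mem x) p).1 hp
  rw [form, LinearMap.BilinForm.congr_apply, h2, h2, LinearEquiv.symm_apply_apply,
    LinearEquiv.symm_apply_apply, C.form_spin hh]

/-- The charge adjoint `Φ^C` of an endomorphism `Φ` of `S_x`, given by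
`C(Φ^C η, ξ) = C(η, Φ ξ)`. -/
def adjoint [FiniteDimensional 𝕜 F] (C : ChargeConjugation ρ) (x : M) (Φ : Module.End 𝕜 (S x)) :
    Module.End 𝕜 (S x) :=
  (σ.framePair x).2.conj
    (C.form.leftAdjointOfNondegenerate C.nondegenerate ((σ.framePair x).2.symm.conj Φ))

theorem form_adjoint [FiniteDimensional 𝕜 F] (C : ChargeConjugation ρ) (x : M)
    (Φ : Module.End 𝕜 (S x)) (η ξ : S x) :
    σ.form C x (σ.adjoint C x Φ η) ξ = σ.form C x η (Φ ξ) := by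
  have := C.form.isAdjointPairLeftAdjointOfNondegenerate C.nondegenerate
    ((σ.framePair x).2.symm.conj Φ) ((σ.framePair x).2.symm η) ((σ.framePair x).2.symm ξ)
  simpa [form, adjoint, LinearEquiv.conj_apply_apply] using this

variable [∀ x, Module ℝ (S x)] [∀ x, IsScalarTower ℝ 𝕜 (S x)]
  [∀ x, IsTopologicalAddGroup (S x)] [∀ x, ContinuousSMul ℝ (S x)]

/-- A connection on `S` is the (spinorial) Levi-Civita connection, if in every local spin frame
`(e, θ)` it is given by `∇_X θ_ψ = ¼ ∑_{a,b} ε_a ε_b g(∇_X e_a, e_b) e_a · e_b · θ_ψ`, i.e. if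
its connection form is the lift to the spin group of the connection form of the Levi-Civita
connection `nabla` of `g`. -/
def IsSpinLeviCivita
    (nabla : CovariantDerivative 𝓘(ℝ, E) E (TangentSpace 𝓘(ℝ, E) : M → Type _))
    (nablaS : CovariantDerivative 𝓘(ℝ, E) F S) : Prop :=
  ∀ (U : Set M) (s : Π y : M, FramePair 𝕜 (E := E) F n S y), σ.IsSpinFrame U s →
    ∀ x ∈ U, ∀ (X : TangentSpace 𝓘(ℝ, E) x) (ψ : F),
      nablaS (fun y => (s y).2 ψ) x X =
        (1 / 4 : ℝ) • ∑ a, ∑ b,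
          (sgn (ε a) * sgn (ε b) *
            g.inner x (nabla (fun y => (s y).1 (Pi.single a 1)) x X) ((s x).1 (Pi.single b 1))) •
            σ.gamma x ((s x).1 (Pi.single a 1)) (σ.gamma x ((s x).1 (Pi.single b 1)) ((s x).2 ψ))

/-- `𝒜 = D - ∇`, as a one-form with values in the (`𝕜`-linear) endomorphisms of `S`. -/
def IsDifference (D nablaS : CovariantDerivative 𝓘(ℝ, E) F S)
    (A : Π x : M, TangentSpace 𝓘(ℝ, E) x →ₗ[ℝ] S x →ₗ[𝕜] S x) : Prop :=
  ∀ (x : M) (ξ : Π y : M, S y) (X : TangentSpace 𝓘(ℝ, E) x), MDiffAt (T% ξ) x →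
    A x X (ξ x) = D ξ x X - nablaS ξ x X

/-- The connection `D^C = ∇ - 𝒜^C` associated to `D = ∇ + 𝒜`, i.e. the one for which
`D ⊗ 1 + 1 ⊗ D^C` makes the charge conjugation parallel. -/
def conjConnection [FiniteDimensional 𝕜 F] (C : ChargeConjugation ρ)
    (nablaS : CovariantDerivative 𝓘(ℝ, E) F S)
    (A : Π x : M, TangentSpace 𝓘(ℝ, E) x →ₗ[ℝ] S x →ₗ[𝕜] S x)
    (ξ : Π y : M, S y) (x : M) (X : TangentSpace 𝓘(ℝ, E) x) : S x :=
  nablaS ξ x X - σ.adjoint C x (A x X) (ξ x)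

/-- `(D̂_Z γ)(X) ξ = D_Z (γ(X) ξ) - γ(∇_Z X) ξ - γ(X) D^C_Z ξ`, at the point `x`. -/
def hatDGamma [FiniteDimensional 𝕜 F] (C : ChargeConjugation ρ)
    (nabla : CovariantDerivative 𝓘(ℝ, E) E (TangentSpace 𝓘(ℝ, E) : M → Type _))
    (nablaS D : CovariantDerivative 𝓘(ℝ, E) F S)
    (A : Π x : M, TangentSpace 𝓘(ℝ, E) x →ₗ[ℝ] S x →ₗ[𝕜] S x)
    (Z X : Π y : M, TangentSpace 𝓘(ℝ, E) y) (ξ : Π y : M, S y) (x : M) : S x :=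
  D (fun y => σ.gamma y (X y) (ξ y)) x (Z x) - σ.gamma x (nabla X x (Z x)) (ξ x)
    - σ.gamma x (X x) (σ.conjConnection C nablaS A ξ x (Z x))

/-- `D` is admissible if `D̂γ` is skew symmetric, `(D̂_Z γ)(X) = -(D̂_X γ)(Z)`. -/
def IsAdmissible [FiniteDimensional 𝕜 F] (C : ChargeConjugation ρ)
    (nabla : CovariantDerivative 𝓘(ℝ, E) E (TangentSpace 𝓘(ℝ, E) : M → Type _))
    (nablaS D : CovariantDerivative 𝓘(ℝ, E) F S)
    (A : Π x : M, TangentSpace 𝓘(ℝ, E) x →ₗ[ℝ] S x →ₗ[𝕜] S x) : Prop :=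
  ∀ (x : M) (Z X : Π y : M, TangentSpace 𝓘(ℝ, E) y) (ξ : Π y : M, S y),
    MDiffAt (T% Z) x → MDiffAt (T% X) x → MDiffAt (T% ξ) x →
      σ.hatDGamma C nabla nablaS D A Z X ξ x = -σ.hatDGamma C nabla nablaS D A X Z ξ x

/-- The endomorphism of `S_x` given by an `ℓ`-form on `T_x M`, see `cliffordOfForm`. -/
def ofForm (x : M) {ℓ : ℕ} (w : TangentSpace 𝓘(ℝ, E) x [⋀^Fin ℓ]→ₗ[ℝ] 𝕜) : Module.End 𝕜 (S x) :=
  cliffordOfForm ε (σ.e x) (σ.gamma x) w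

/-- `𝒜` is homogeneous of degree `ℓ`: every `𝒜_X` is given by an `ℓ`-form. -/
def IsHomogeneous (A : Π x : M, TangentSpace 𝓘(ℝ, E) x →ₗ[ℝ] S x →ₗ[𝕜] S x) (ℓ : ℕ) : Prop :=
  ∀ (x : M) (X : TangentSpace 𝓘(ℝ, E) x),
    ∃ w : TangentSpace 𝓘(ℝ, E) x [⋀^Fin ℓ]→ₗ[ℝ] 𝕜, A x X = σ.ofForm x w

/-- The metric of `T_x M` as a bilinear map. -/
def metric (g : PseudoRiemannianMetric E M) (x : M) :
    TangentSpace 𝓘(ℝ, E) x →ₗ[ℝ] TangentSpace 𝓘(ℝ, E) x →ₗ[ℝ] ℝ :=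
  (ContinuousLinearMap.coeLM ℝ) ∘ₗ (g.inner x : _ →ₗ[ℝ] _)

/-- The decomposition `𝒜_X = X ⌟ F + X ∧ G + 𝒜₀(X)` of a homogeneous `𝒜` of degree `ℓ`
according to `Ω¹ ⊗ Ω^ℓ = Ω^{ℓ+1} ⊕ Ω^{ℓ-1} ⊕ Ω^{(ℓ,1)}`.  The last summand consists of the tensors
with vanishing skew symmetrization and vanishing metric trace. -/
structure IsDecomposition (A : Π x : M, TangentSpace 𝓘(ℝ, E) x →ₗ[ℝ] S x →ₗ[𝕜] S x) (ℓ : ℕ)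
    (Fform : Π x : M, TangentSpace 𝓘(ℝ, E) x [⋀^Fin (ℓ + 1)]→ₗ[ℝ] 𝕜)
    (Gform : Π x : M, TangentSpace 𝓘(ℝ, E) x [⋀^Fin (ℓ - 1)]→ₗ[ℝ] 𝕜)
    (A₀ : Π x : M, TangentSpace 𝓘(ℝ, E) x →ₗ[ℝ] TangentSpace 𝓘(ℝ, E) x [⋀^Fin ℓ]→ₗ[ℝ] 𝕜) :
    Prop where
  /-- there are no forms of degree `-1` -/
  lower_eq_zero : ℓ = 0 → Gform = 0
  alternation_eq_zero : ∀ x, AlternatingMap.alternatizeUncurryFin (A₀ x) = 0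
  trace_eq_zero : ∀ x, formTrace ε (σ.e x) ℓ (A₀ x) = 0
  eq : ∀ (x : M) (X : TangentSpace 𝓘(ℝ, E) x),
    A x X = σ.ofForm x ((Fform x).curryLeft X + wedge (metric g x) ℓ X (Gform x) + A₀ x X)

end SpinStructure

end Spin

end SpinGeometry

end

/-!
Clifford multiplication is parallel, because in a spin frame the spin connection is the lift to
spinors of the Levi-Civita connection form.  Hence `(D̂_Z γ)(X) = 𝒜_Z X + X (𝒜_Z)^C` is tensorial,
and by polarization `D` is admissible if and only if `𝒜_X X + X (𝒜_X)^C = 0` for every tangent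
vector `X`.

The charge adjoint of an `ℓ`-form is `Δ₀ Δ_ℓ` times the form, and the Clifford commutator or
anticommutator of `X` with an `ℓ`-form `w` is twice `X ∧ w` or twice `X ⌟ w`, depending on the
parity of `ℓ`.  Admissibility thus says that `X ∧ 𝒜_X = 0` for all `X`, which leaves only the part
`X ∧ G` of `𝒜`, or that `X ⌟ 𝒜_X = 0` for all `X`, which leaves only the part `X ⌟ F`.
-/

noncomputable section

namespace SpinGeometry

/-! ### Contraction and exterior multiplication -/

section FormAlgebra

open AlternatingMap

variable {R T N : Type*} [CommRing R] [AddCommGroup T] [Module R T] [AddCommGroup N] [Module R N]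
  {ℓ : ℕ}

/-- The contraction `X ⌟ w` in every degree; it vanishes on forms of degree `0`, where the target
`Λ^(0 - 1)` is `Λ^0` by truncated subtraction. -/
def contract : {ℓ : ℕ} → T →ₗ[R] (T [⋀^Fin ℓ]→ₗ[R] N) →ₗ[R] T [⋀^Fin (ℓ - 1)]→ₗ[R] N
  | 0 => 0
  | _ + 1 => curryLeftLinearMap.flip

theorem contract_succ (X : T) (w : T [⋀^Fin (ℓ + 1)]→ₗ[R] N) :
    contract X w = w.curryLeft X := rfl

theorem contract_contract_self (X : T) (w : T [⋀^Fin ℓ]→ₗ[R] N) :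
    contract X (contract X w) = 0 := by
  match ℓ, w with
  | 0, _ | 1, _ => rfl
  | ℓ + 2, w => exact w.curryLeft_same X

theorem contract_contract_comm (X Y : T) (w : T [⋀^Fin ℓ]→ₗ[R] N) :
    contract X (contract Y w) = -contract Y (contract X w) := by
  have h := contract_contract_self (X + Y) w
  simp only [map_add, LinearMap.add_apply, contract_contract_self, zero_add, add_zero] at h
  exact eq_neg_of_add_eq_zero_right h

/-- The exterior product `X ∧ G` of the one-form `B X` with a form of degree `ℓ - 1`, as a bilinear
map. There are no forms of degree `-1`, so it vanishes for `ℓ = 0`. -/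
def wedgeLM (B : T →ₗ[R] T →ₗ[R] R) :
    (ℓ : ℕ) → T →ₗ[R] (T [⋀^Fin (ℓ - 1)]→ₗ[R] N) →ₗ[R] T [⋀^Fin ℓ]→ₗ[R] N
  | 0 => 0
  | _ + 1 => (LinearMap.smulRightₗ ∘ₗ B).compr₂ alternatizeUncurryFinLM

theorem wedgeLM_succ (B : T →ₗ[R] T →ₗ[R] R) (X : T) (w : T [⋀^Fin ℓ]→ₗ[R] N) :
    wedgeLM B (ℓ + 1) X w = alternatizeUncurryFin ((B X).smulRight w) := rfl

theorem wedgeLM_apply {𝕜 T : Type*} [RCLike 𝕜] [AddCommGroup T] [Module ℝ T]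
    (B : T →ₗ[ℝ] T →ₗ[ℝ] ℝ) (X : T) (G : T [⋀^Fin (ℓ - 1)]→ₗ[ℝ] 𝕜) :
    wedgeLM B ℓ X G = wedge B ℓ X G := by
  cases ℓ <;> rfl

theorem curryLeft_alternatizeUncurryFin_zero (α : T →ₗ[R] T [⋀^Fin 0]→ₗ[R] N) (X : T) :
    (alternatizeUncurryFin α).curryLeft X = α X := by
  ext v
  simp [alternatizeUncurryFin_apply]

theorem curryLeft_alternatizeUncurryFin_succ (α : T →ₗ[R] T [⋀^Fin (ℓ + 1)]→ₗ[R] N) (X : T) :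
    (alternatizeUncurryFin α).curryLeft X =
      α X - alternatizeUncurryFin (n := ℓ) (contract X ∘ₗ α) := by
  ext v
  have hremove (i : Fin (ℓ + 1)) :
      i.succ.removeNth (Matrix.vecCons X v) = Matrix.vecCons X (i.removeNth v) := by
    ext j
    refine Fin.cases ?_ (fun j => ?_) j <;> simp [Fin.removeNth]
  rw [curryLeft_apply_apply, alternatizeUncurryFin_apply, Fin.sum_univ_succ,
    AlternatingMap.sub_apply, alternatizeUncurryFin_apply, sub_eq_add_neg, ← Finset.sum_neg_distrib]
  congr 1
  · simp [Matrix.vecCons]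
  · refine Finset.sum_congr rfl fun i _ => ?_
    rw [hremove, Matrix.cons_val_succ, Fin.val_succ, pow_succ, mul_neg_one, neg_smul]
    rfl

theorem curryLeft_wedgeLM (B : T →ₗ[R] T →ₗ[R] R) (X Z : T) (w : T [⋀^Fin ℓ]→ₗ[R] N) :
    (wedgeLM B (ℓ + 1) Z w).curryLeft X = B Z X • w - wedgeLM B ℓ Z (contract X w) := by
  cases ℓ with
  | zero =>
    rw [wedgeLM_succ, curryLeft_alternatizeUncurryFin_zero]
    exact (sub_zero _).symm
  | succ ℓ =>
    have hcomp : contract X ∘ₗ (B Z).smulRight w = (B Z).smulRight (contract X w) := by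
      ext1 Y
      simp
    rw [wedgeLM_succ, curryLeft_alternatizeUncurryFin_succ, hcomp]
    rfl

theorem alternatizeUncurryFin_wedgeLM_flip {B : T →ₗ[R] T →ₗ[R] R} (hB : ∀ X Y, B X Y = B Y X)
    (G : T [⋀^Fin (ℓ - 1)]→ₗ[R] N) : alternatizeUncurryFin ((wedgeLM B ℓ).flip G) = 0 := by
  cases ℓ with
  | zero => exact alternatizeUncurryFinLM.map_zero
  | succ ℓ =>
    exact alternatizeUncurryFin_alternatizeUncurryFinLM_comp_of_symmetric
      (f := LinearMap.smulRightₗ.flip G ∘ₗ B) fun X Y => by simp [hB X Y]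

theorem wedgeLM_wedgeLM_self (B : T →ₗ[R] T →ₗ[R] R) (Z : T) (G : T [⋀^Fin (ℓ - 1)]→ₗ[R] N) :
    wedgeLM B (ℓ + 1) Z (wedgeLM B ℓ Z G) = 0 := by
  cases ℓ with
  | zero => exact map_zero _
  | succ ℓ =>
    have hcomp : (B Z).smulRight (wedgeLM B (ℓ + 1) Z G) =
        alternatizeUncurryFinLM ∘ₗ (B Z).smulRight ((B Z).smulRight G) := by
      ext1 X
      exact (map_smul alternatizeUncurryFinLM _ _).symm
    rw [wedgeLM_succ, hcomp]
    exact alternatizeUncurryFin_alternatizeUncurryFinLM_comp_of_symmetric fun X Y => by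
      simp [smul_comm (B Z X)]

end FormAlgebra

/-! ### Orthonormal frames and the metric trace -/

theorem sgn_mul_self (s : ℤˣ) : sgn s * sgn s = 1 := by
  rcases Int.units_eq_one_or s with rfl | rfl <;> simp [sgn]

/-- The vectors `e_a` span `T` and are orthonormal for the symmetric bilinear form `B`, with
`B(e_a, e_b) = ε_a δ_ab`. Spanning and orthogonality are encoded by the expansion
`X = ∑ ε_a B(e_a, X) e_a`. -/
structure IsOrthonormalFrame {T : Type*} [AddCommGroup T] [Module ℝ T] {n : ℕ} (ε : Fin n → ℤˣ)
    (e : Fin n → T) (B : T →ₗ[ℝ] T →ₗ[ℝ] ℝ) : Prop where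
  symm : ∀ X Y, B X Y = B Y X
  norm : ∀ a, B (e a) (e a) = sgn (ε a)
  expand : ∀ X, ∑ a, (sgn (ε a) * B (e a) X) • e a = X

section Trace

open AlternatingMap

variable {𝕜 : Type*} [RCLike 𝕜] {T : Type*} [AddCommGroup T] [Module ℝ T]
  {n : ℕ} {ε : Fin n → ℤˣ} {e : Fin n → T} {B : T →ₗ[ℝ] T →ₗ[ℝ] ℝ} {ℓ : ℕ}

theorem formTrace_eq_sum_contract (α : T →ₗ[ℝ] T [⋀^Fin ℓ]→ₗ[ℝ] 𝕜) :
    formTrace ε e ℓ α = ∑ a, sgn (ε a) • contract (e a) (α (e a)) := by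
  cases ℓ with
  | zero => exact (Finset.sum_eq_zero fun a _ => smul_zero _).symm
  | succ ℓ => rfl

theorem formTrace_add (α β : T →ₗ[ℝ] T [⋀^Fin ℓ]→ₗ[ℝ] 𝕜) :
    formTrace ε e ℓ (α + β) = formTrace ε e ℓ α + formTrace ε e ℓ β := by
  simp [formTrace_eq_sum_contract, Finset.sum_add_distrib]

theorem formTrace_curryLeft (w : T [⋀^Fin (ℓ + 1)]→ₗ[ℝ] 𝕜) : formTrace ε e ℓ w.curryLeft = 0 := by
  rw [formTrace_eq_sum_contract]
  refine Finset.sum_eq_zero fun a _ => ?_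
  rw [← contract_succ]
  exact (congrArg _ (contract_contract_self (e a) w)).trans (smul_zero _)

namespace IsOrthonormalFrame

theorem sum_smul_map (h : IsOrthonormalFrame ε e B) {V : Type*} [AddCommGroup V] [Module ℝ V]
    (f : T →ₗ[ℝ] V) (X : T) : ∑ a, (sgn (ε a) * B (e a) X) • f (e a) = f X := by
  conv_rhs => rw [← h.expand X]
  simp only [map_sum, map_smul]

theorem sum_sgn_mul_norm (h : IsOrthonormalFrame ε e B) : ∑ a, sgn (ε a) * B (e a) (e a) = n := by
  simp [h.norm, sgn_mul_self]

theorem sum_wedgeLM (h : IsOrthonormalFrame ε e B) (α : T →ₗ[ℝ] T [⋀^Fin ℓ]→ₗ[ℝ] 𝕜) :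
    ∑ a, sgn (ε a) • wedgeLM B (ℓ + 1) (e a) (α (e a)) = alternatizeUncurryFin α := by
  have hα : α = ∑ a, sgn (ε a) • (B (e a)).smulRight (α (e a)) := by
    ext1 X
    rw [← h.sum_smul_map α X]
    simp [mul_smul]
  conv_rhs => rw [hα, ← alternatizeUncurryFinLM_apply, map_sum]
  simp only [map_smul]
  rfl

theorem sum_wedgeLM_contract (h : IsOrthonormalFrame ε e B) (w : T [⋀^Fin ℓ]→ₗ[ℝ] 𝕜) :
    ∑ a, sgn (ε a) • wedgeLM B ℓ (e a) (contract (e a) w) = (ℓ : ℝ) • w := by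
  cases ℓ with
  | zero => simp [wedgeLM]
  | succ ℓ =>
    rw [Nat.cast_smul_eq_nsmul, ← alternatizeUncurryFin_curryLeft]
    exact h.sum_wedgeLM w.curryLeft

theorem formTrace_wedgeLM_flip (h : IsOrthonormalFrame ε e B) {G : T [⋀^Fin (ℓ - 1)]→ₗ[ℝ] 𝕜}
    (hG : ℓ = 0 → G = 0) :
    formTrace ε e ℓ ((wedgeLM B ℓ).flip G) = ((n : ℝ) - ℓ + 1) • G := by
  cases ℓ with
  | zero => rw [hG rfl, smul_zero]; rfl
  | succ ℓ =>
    change T [⋀^Fin ℓ]→ₗ[ℝ] 𝕜 at G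
    calc ∑ a, sgn (ε a) • (wedgeLM B (ℓ + 1) (e a) G).curryLeft (e a)
        = (∑ a, sgn (ε a) * B (e a) (e a)) • G
            - ∑ a, sgn (ε a) • wedgeLM B ℓ (e a) (contract (e a) G) := by
          simp only [curryLeft_wedgeLM, smul_sub, Finset.sum_sub_distrib, smul_smul,
            Finset.sum_smul]
      _ = ((n : ℝ) - (ℓ + 1 : ℕ) + 1) • G := by
          rw [h.sum_sgn_mul_norm, h.sum_wedgeLM_contract]
          push_cast
          module

theorem smul_eq_wedgeLM_of_wedgeLM_self_eq_zero (h : IsOrthonormalFrame ε e B)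
    {α : T →ₗ[ℝ] T [⋀^Fin ℓ]→ₗ[ℝ] 𝕜} (hα : ∀ X, wedgeLM B (ℓ + 1) X (α X) = 0) (Z : T) :
    ((n : ℝ) - ℓ + 1) • α Z = wedgeLM B ℓ Z (formTrace ε e ℓ α) := by
  have hpolar : ∀ X, wedgeLM B (ℓ + 1) Z (α X) + wedgeLM B (ℓ + 1) X (α Z) = 0 := fun X => by
    have hadd := hα (X + Z)
    simpa only [map_add, LinearMap.add_apply, hα, zero_add, add_zero] using hadd
  have hexpand : ∑ a, (sgn (ε a) * B Z (e a)) • α (e a) = α Z := by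
    simpa only [h.symm Z] using h.sum_smul_map α Z
  have htrace : ∑ a, sgn (ε a) • (wedgeLM B (ℓ + 1) Z (α (e a)) +
      wedgeLM B (ℓ + 1) (e a) (α Z)).curryLeft (e a) = 0 := by
    simp [hpolar]
  simp only [curryLeft_add, LinearMap.add_apply, curryLeft_wedgeLM, smul_add, smul_sub, smul_smul,
    Finset.sum_add_distrib, Finset.sum_sub_distrib] at htrace
  rw [hexpand, ← Finset.sum_smul, h.sum_sgn_mul_norm, h.sum_wedgeLM_contract] at htrace
  rw [formTrace_eq_sum_contract, map_sum]
  simp only [map_smul]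
  rw [← sub_eq_zero, ← htrace]
  module

end IsOrthonormalFrame

theorem smul_eq_curryLeft_of_contract_self_eq_zero {α : T →ₗ[ℝ] T [⋀^Fin ℓ]→ₗ[ℝ] 𝕜}
    (hα : ∀ X, contract X (α X) = 0) (Z : T) :
    ((ℓ : ℝ) + 1) • α Z = (alternatizeUncurryFin α).curryLeft Z := by
  cases ℓ with
  | zero => rw [curryLeft_alternatizeUncurryFin_zero]; simp
  | succ ℓ =>
    have hpolar : (contract Z ∘ₗ α : T →ₗ[ℝ] T [⋀^Fin ℓ]→ₗ[ℝ] 𝕜) = -(α Z).curryLeft := by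
      ext1 X
      have hadd := hα (X + Z)
      simp only [map_add, LinearMap.add_apply, hα, zero_add, add_zero] at hadd
      exact eq_neg_of_add_eq_zero_left hadd
    rw [curryLeft_alternatizeUncurryFin_succ, hpolar, ← neg_one_smul ℝ, alternatizeUncurryFin_smul,
      alternatizeUncurryFin_curryLeft, ← Nat.cast_smul_eq_nsmul ℝ]
    push_cast
    module

end Trace

/-! ### Signs -/

section Signs

variable (d₀ d₁ : ℤˣ) (k : ℤ)

theorem Delta_zero : Delta d₀ d₁ 0 = d₀ := by
  simp [Delta]

theorem Delta_add_one : Delta d₀ d₁ (k + 1) = (-1) ^ k * (d₀ * d₁) * Delta d₀ d₁ k := by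
  have htriangle : (k + 1) * (k + 1 - 1) / 2 = k * (k - 1) / 2 + k := by
    rw [← Int.add_mul_ediv_left _ _ two_ne_zero]
    ring_nf
  rw [Delta, Delta, htriangle, zpow_add, zpow_add_one d₀ (k + 1), zpow_add_one d₁]
  ac_rfl

theorem Delta_one : Delta d₀ d₁ 1 = d₁ := by
  simpa [Delta_zero, mul_right_comm] using Delta_add_one d₀ d₁ 0

theorem Delta_antiperiodic : Function.Antiperiodic (Delta d₀ d₁) 2 := fun k => by
  rw [← one_add_one_eq_two, ← add_assoc, Delta_add_one, Delta_add_one, zpow_add_one]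
  calc (-1) ^ k * -1 * (d₀ * d₁) * ((-1) ^ k * (d₀ * d₁) * Delta d₀ d₁ k)
      = (-1) ^ k * (-1) ^ k * (d₀ * d₁ * (d₀ * d₁)) * (-1 * Delta d₀ d₁ k) := by ac_rfl
    _ = -Delta d₀ d₁ k := by
      rw [Int.units_mul_self, Int.units_mul_self, one_mul, one_mul, neg_one_mul]

theorem Delta_one_mul_Delta_add_one :
    Delta d₀ d₁ 1 * Delta d₀ d₁ (k + 1) = (-1) ^ k * (d₀ * Delta d₀ d₁ k) := by
  rw [Delta_one, Delta_add_one]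
  calc d₁ * ((-1) ^ k * (d₀ * d₁) * Delta d₀ d₁ k)
      = d₁ * d₁ * ((-1) ^ k * (d₀ * Delta d₀ d₁ k)) := by ac_rfl
    _ = (-1) ^ k * (d₀ * Delta d₀ d₁ k) := by rw [Int.units_mul_self, one_mul]

theorem Delta_one_mul_Delta_add_one_eq_neg_one_iff :
    Delta d₀ d₁ 1 * Delta d₀ d₁ (k + 1) = -1 ↔ d₀ * Delta d₀ d₁ k = -(-1) ^ k := by
  rw [Delta_one_mul_Delta_add_one, ← eq_inv_mul_iff_mul_eq, Int.units_inv_eq_self,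
    mul_neg_one]

theorem Delta_one_mul_Delta_sub_one_eq_neg_one_iff :
    Delta d₀ d₁ 1 * Delta d₀ d₁ (k - 1) = -1 ↔ d₀ * Delta d₀ d₁ k = (-1) ^ k := by
  have hanti : Delta d₀ d₁ (k + 1) = -Delta d₀ d₁ (k - 1) := by
    rw [← Delta_antiperiodic]
    ring_nf
  have h := Delta_one_mul_Delta_add_one d₀ d₁ k
  rw [hanti, mul_neg, neg_eq_iff_eq_neg] at h
  rw [h, neg_inj, mul_eq_one_iff_inv_eq, Int.units_inv_eq_self, eq_comm]

theorem Delta_one_mul_eq_neg_one_iff :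
    Delta d₀ d₁ 1 * Delta d₀ d₁ k = -1 ↔ Delta d₀ d₁ 0 * Delta d₀ d₁ (k - 1) = (-1) ^ k := by
  obtain ⟨k, rfl⟩ : ∃ j, k = j + 1 := ⟨k - 1, by ring⟩
  rw [Delta_one_mul_Delta_add_one_eq_neg_one_iff, Delta_zero, add_sub_cancel_right, zpow_add_one,
    mul_neg_one]

theorem Delta_one_mul_eq_neg_one_iff_modEq :
    Delta d₀ d₁ 1 * Delta d₀ d₁ k = -1 ↔
      k ≡ 3 [ZMOD 4] ∨ k ≡ 1 + ((Delta d₀ d₁ 0 * Delta d₀ d₁ 1 : ℤˣ) : ℤ) [ZMOD 4] := by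
  have hperiodic : Function.Periodic (Delta d₀ d₁) 4 := (Delta_antiperiodic d₀ d₁).periodic_two_mul
  have hmod : Delta d₀ d₁ (k % 4) = Delta d₀ d₁ k := by
    rw [Int.emod_def, mul_comm]
    exact hperiodic.sub_int_mul_eq (k / 4)
  have hfour : k % 4 = 0 ∨ k % 4 = 1 ∨ k % 4 = 2 ∨ k % 4 = 3 := by omega
  rw [← hmod, Int.ModEq, Int.ModEq]
  rcases hfour with h | h | h | h <;> rw [h] <;>
    rcases Int.units_eq_one_or d₀ with rfl | rfl <;>
    rcases Int.units_eq_one_or d₁ with rfl | rfl <;> decide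

end Signs

/-! ### Decomposition of one-forms with values in forms -/

section Decomposition

open AlternatingMap

variable {𝕜 : Type*} [RCLike 𝕜] {T : Type*} [AddCommGroup T] [Module ℝ T]
  {n : ℕ} {ε : Fin n → ℤˣ} {e : Fin n → T} {B : T →ₗ[ℝ] T →ₗ[ℝ] ℝ} {ℓ : ℕ}

/-- The decomposition `α(X) = X ⌟ F + X ∧ G + A₀(X)` of an element of `T* ⊗ Λ^ℓ T*`, in which `A₀`
has vanishing skew symmetrization and metric trace. It is the pointwise, form-valued version of
`SpinStructure.IsDecomposition`. -/
structure IsFormDecomposition (ε : Fin n → ℤˣ) (e : Fin n → T) (B : T →ₗ[ℝ] T →ₗ[ℝ] ℝ)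
    (α : T →ₗ[ℝ] T [⋀^Fin ℓ]→ₗ[ℝ] 𝕜) (F : T [⋀^Fin (ℓ + 1)]→ₗ[ℝ] 𝕜)
    (G : T [⋀^Fin (ℓ - 1)]→ₗ[ℝ] 𝕜) (A₀ : T →ₗ[ℝ] T [⋀^Fin ℓ]→ₗ[ℝ] 𝕜) : Prop where
  lower_eq_zero : ℓ = 0 → G = 0
  alternation_eq_zero : alternatizeUncurryFin A₀ = 0
  trace_eq_zero : formTrace ε e ℓ A₀ = 0
  eq : α = F.curryLeft + (wedgeLM B ℓ).flip G + A₀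

variable {α A₀ A₀' : T →ₗ[ℝ] T [⋀^Fin ℓ]→ₗ[ℝ] 𝕜} {F F' : T [⋀^Fin (ℓ + 1)]→ₗ[ℝ] 𝕜}
  {G G' : T [⋀^Fin (ℓ - 1)]→ₗ[ℝ] 𝕜}

theorem cast_sub_cast_add_one_ne_zero (hℓ : ℓ ≠ n + 1) : (n : ℝ) - ℓ + 1 ≠ 0 := fun h =>
  hℓ (by exact_mod_cast (by linarith : (ℓ : ℝ) = n + 1))

namespace IsFormDecomposition

theorem alternatizeUncurryFin_eq (hB : ∀ X Y, B X Y = B Y X)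
    (hd : IsFormDecomposition ε e B α F G A₀) : alternatizeUncurryFin α = ((ℓ : ℝ) + 1) • F := by
  rw [hd.eq, alternatizeUncurryFin_add, alternatizeUncurryFin_add, hd.alternation_eq_zero,
    alternatizeUncurryFin_wedgeLM_flip hB, alternatizeUncurryFin_curryLeft,
    ← Nat.cast_smul_eq_nsmul ℝ, add_zero, add_zero, Nat.cast_succ]

theorem formTrace_eq (h : IsOrthonormalFrame ε e B) (hd : IsFormDecomposition ε e B α F G A₀) :
    formTrace ε e ℓ α = ((n : ℝ) - ℓ + 1) • G := by
  rw [hd.eq, formTrace_add, formTrace_add, hd.trace_eq_zero, formTrace_curryLeft,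
    h.formTrace_wedgeLM_flip hd.lower_eq_zero, zero_add, add_zero]

theorem unique (h : IsOrthonormalFrame ε e B) (hℓ : ℓ ≠ n + 1)
    (hd : IsFormDecomposition ε e B α F G A₀) (hd' : IsFormDecomposition ε e B α F' G' A₀') :
    F = F' ∧ G = G' ∧ A₀ = A₀' := by
  obtain rfl : F = F' := smul_right_injective _ (Nat.cast_add_one_ne_zero ℓ : (ℓ : ℝ) + 1 ≠ 0)
    ((hd.alternatizeUncurryFin_eq h.symm).symm.trans (hd'.alternatizeUncurryFin_eq h.symm))
  obtain rfl : G = G' := smul_right_injective _ (cast_sub_cast_add_one_ne_zero hℓ)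
    ((hd.formTrace_eq h).symm.trans (hd'.formTrace_eq h))
  exact ⟨rfl, rfl, add_left_cancel (hd.eq.symm.trans hd'.eq)⟩

theorem forall_wedgeLM_self_eq_zero_iff (h : IsOrthonormalFrame ε e B) (hℓ : ℓ ≠ n + 1)
    (hd : IsFormDecomposition ε e B α F G A₀) :
    (∀ Z, wedgeLM B (ℓ + 1) Z (α Z) = 0) ↔ A₀ = 0 ∧ F = 0 := by
  constructor
  · intro hZ
    have hα : α = (wedgeLM B ℓ).flip G := by
      ext1 Z
      refine smul_right_injective _ (cast_sub_cast_add_one_ne_zero hℓ) ?_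
      refine (h.smul_eq_wedgeLM_of_wedgeLM_self_eq_zero hZ Z).trans ?_
      rw [hd.formTrace_eq h, map_smul]
      rfl
    have hF : F = 0 := by
      have halt := hd.alternatizeUncurryFin_eq h.symm
      rw [hα, alternatizeUncurryFin_wedgeLM_flip h.symm] at halt
      exact (smul_eq_zero.1 halt.symm).resolve_left (Nat.cast_add_one_ne_zero ℓ)
    have heq := hd.eq
    rw [hF, hα] at heq
    exact ⟨by simpa using heq, hF⟩
  · rintro ⟨rfl, rfl⟩ Z
    rw [hd.eq, AlternatingMap.curryLeft_zero, zero_add, add_zero]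
    exact wedgeLM_wedgeLM_self B Z G

theorem forall_contract_self_eq_zero_iff (h : IsOrthonormalFrame ε e B) (hℓ : ℓ ≠ n + 1)
    (hd : IsFormDecomposition ε e B α F G A₀) :
    (∀ Z, contract Z (α Z) = 0) ↔ A₀ = 0 ∧ G = 0 := by
  constructor
  · intro hZ
    have hα : α = F.curryLeft := by
      ext1 Z
      refine smul_right_injective _ (Nat.cast_add_one_ne_zero ℓ : (ℓ : ℝ) + 1 ≠ 0) ?_
      refine (smul_eq_curryLeft_of_contract_self_eq_zero hZ Z).trans ?_
      rw [hd.alternatizeUncurryFin_eq h.symm, curryLeft_smul]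
      rfl
    have hG : G = 0 := by
      have htrace := hd.formTrace_eq h
      rw [hα, formTrace_curryLeft] at htrace
      exact (smul_eq_zero.1 htrace.symm).resolve_left (cast_sub_cast_add_one_ne_zero hℓ)
    have heq := hd.eq
    rw [hG, hα] at heq
    exact ⟨by simpa using heq, hG⟩
  · rintro ⟨rfl, rfl⟩ Z
    rw [hd.eq, LinearMap.map_zero, add_zero, add_zero]
    exact contract_contract_self Z F

end IsFormDecomposition

theorem IsOrthonormalFrame.exists_isFormDecomposition (h : IsOrthonormalFrame ε e B)
    (hℓ : ℓ ≠ n + 1) (α : T →ₗ[ℝ] T [⋀^Fin ℓ]→ₗ[ℝ] 𝕜) :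
    ∃ F G A₀, IsFormDecomposition ε e B α F G A₀ := by
  set F := ((ℓ : ℝ) + 1)⁻¹ • alternatizeUncurryFin α with hF
  set G := ((n : ℝ) - ℓ + 1)⁻¹ • formTrace ε e ℓ α with hG
  have hlower : ℓ = 0 → G = 0 := by
    rintro rfl
    exact smul_zero _
  have hα : α = F.curryLeft + (wedgeLM B ℓ).flip G +
      (α - F.curryLeft - (wedgeLM B ℓ).flip G) := by abel
  refine ⟨F, G, _, hlower, ?_, ?_, hα⟩
  · have halt := congrArg alternatizeUncurryFin hα
    rw [alternatizeUncurryFin_add, alternatizeUncurryFin_add,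
      alternatizeUncurryFin_wedgeLM_flip h.symm, alternatizeUncurryFin_curryLeft, add_zero,
      ← Nat.cast_smul_eq_nsmul ℝ, Nat.cast_succ, hF,
      smul_inv_smul₀ (Nat.cast_add_one_ne_zero ℓ : (ℓ : ℝ) + 1 ≠ 0)] at halt
    exact left_eq_add.1 halt
  · have htrace := congrArg (formTrace ε e ℓ) hα
    rw [formTrace_add, formTrace_add, formTrace_curryLeft, h.formTrace_wedgeLM_flip hlower,
      zero_add, hG, smul_inv_smul₀ (cast_sub_cast_add_one_ne_zero hℓ)] at htrace
    exact left_eq_add.1 htrace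

end Decomposition

/-! ### The action of forms on spinors -/

section CliffordAction

open AlternatingMap (curryLeft_apply_apply)

variable {𝕜 : Type*} [RCLike 𝕜] {T : Type*} [AddCommGroup T] [Module ℝ T]
  {S : Type*} [AddCommGroup S] [Module ℝ S] [Module 𝕜 S] [IsScalarTower ℝ 𝕜 S]
  {n : ℕ} {ε : Fin n → ℤˣ} {e : Fin n → T} {B : T →ₗ[ℝ] T →ₗ[ℝ] ℝ}
  {γ : T →ₗ[ℝ] Module.End 𝕜 S} {ℓ : ℕ}

/-- `γ` satisfies the Clifford relations `X Y + Y X = -2 B(X, Y)`. -/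
def IsCliffordMap (B : T →ₗ[ℝ] T →ₗ[ℝ] ℝ) (γ : T →ₗ[ℝ] Module.End 𝕜 S) : Prop :=
  ∀ X Y, γ X * γ Y + γ Y * γ X = (-2 * B X Y) • (1 : Module.End 𝕜 S)

/-- The action `cliffordOfForm` of `ℓ`-forms on spinors, as a linear map. -/
def cliffordLM (ε : Fin n → ℤˣ) (e : Fin n → T) (γ : T →ₗ[ℝ] Module.End 𝕜 S) {ℓ : ℕ} :
    (T [⋀^Fin ℓ]→ₗ[ℝ] 𝕜) →ₗ[ℝ] Module.End 𝕜 S where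
  toFun w := cliffordOfForm ε e γ w
  map_add' v w := by
    simp [cliffordOfForm, mul_add, add_smul, Finset.sum_add_distrib]
  map_smul' r w := by
    simp only [cliffordOfForm, AlternatingMap.smul_apply, RingHom.id_apply, mul_smul_comm,
      smul_assoc, ← Finset.smul_sum]
    rw [smul_comm]

local notation "𝔠" => cliffordLM ε e γ

theorem cliffordLM_zero (w : T [⋀^Fin 0]→ₗ[ℝ] 𝕜) : 𝔠 w = w ![] • (1 : Module.End 𝕜 S) := by
  simp [cliffordLM, cliffordOfForm, Matrix.empty_eq]

theorem cliffordLM_succ (w : T [⋀^Fin (ℓ + 1)]→ₗ[ℝ] 𝕜) :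
    ((ℓ : ℝ) + 1) • 𝔠 w = ∑ a, sgn (ε a) • (γ (e a) * 𝔠 (w.curryLeft (e a))) := by
  have hfactorial : ((ℓ : ℝ) + 1) • ((ℓ + 1).factorial : 𝕜)⁻¹ = (ℓ.factorial : 𝕜)⁻¹ := by
    have hℓ : (ℓ : 𝕜) + 1 ≠ 0 := Nat.cast_add_one_ne_zero ℓ
    rw [Nat.factorial_succ, Algebra.smul_def]
    push_cast
    rw [mul_inv, mul_inv_cancel_left₀ hℓ]
  have hterm (a : Fin n) (J : Fin ℓ → Fin n) :
      (((∏ j, sgn (ε (Fin.cons (α := fun _ => Fin n) a J j)) : ℝ) : 𝕜) *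
          w fun j => e (Fin.cons (α := fun _ => Fin n) a J j)) •
          (List.ofFn fun j => γ (e (Fin.cons (α := fun _ => Fin n) a J j))).prod =
        sgn (ε a) • (γ (e a) * (((∏ j, sgn (ε (J j)) : ℝ) : 𝕜) *
          w.curryLeft (e a) fun j => e (J j)) • (List.ofFn fun j => γ (e (J j))).prod) := by
    have hcons : (fun j => e (Fin.cons (α := fun _ => Fin n) a J j)) =
        Matrix.vecCons (e a) fun j => e (J j) := by
      ext j
      refine Fin.cases ?_ (fun j => ?_) j <;> simp
    rw [hcons, ← curryLeft_apply_apply, Fin.prod_univ_succ, List.ofFn_succ, List.prod_cons]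
    simp only [Fin.cons_zero, Fin.cons_succ, RCLike.ofReal_mul, mul_assoc]
    rw [mul_smul, mul_smul_comm, ← RCLike.real_smul_eq_coe_smul]
  simp only [cliffordLM, LinearMap.coe_mk, AddHom.coe_mk, cliffordOfForm]
  rw [← smul_assoc, hfactorial, ← (Fin.consEquiv fun _ => Fin n).sum_comp, Fintype.sum_prod_type]
  simp only [Fin.consEquiv_apply, hterm, mul_smul_comm, Finset.mul_sum, Finset.smul_sum]
  exact Finset.sum_congr rfl fun a _ => Finset.sum_congr rfl fun J _ => smul_comm _ _ _

theorem smul_cliffordLM (w : T [⋀^Fin ℓ]→ₗ[ℝ] 𝕜) :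
    (ℓ : ℝ) • 𝔠 w = ∑ a, sgn (ε a) • (γ (e a) * 𝔠 (contract (e a) w)) := by
  cases ℓ with
  | zero => simp [contract]
  | succ ℓ =>
    rw [Nat.cast_succ]
    exact cliffordLM_succ w

theorem sum_mul_cliffordLM_contract_contract (w : T [⋀^Fin (ℓ + 1)]→ₗ[ℝ] 𝕜) (Z : T) :
    ∑ a, sgn (ε a) • (γ (e a) * 𝔠 (contract Z (w.curryLeft (e a)))) =
      -(ℓ : ℝ) • 𝔠 (w.curryLeft Z) := by
  rw [neg_smul, smul_cliffordLM, ← Finset.sum_neg_distrib]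
  refine Finset.sum_congr rfl fun a _ => ?_
  have hanti : contract (e a) (w.curryLeft Z) = -contract Z (w.curryLeft (e a)) :=
    contract_contract_comm (e a) Z w
  rw [hanti, map_neg, mul_neg, smul_neg, neg_neg]

theorem IsOrthonormalFrame.smul_cliffordLM_wedgeLM (h : IsOrthonormalFrame ε e B)
    (γ : T →ₗ[ℝ] Module.End 𝕜 S) (w : T [⋀^Fin ℓ]→ₗ[ℝ] 𝕜) (Z : T) :
    ((ℓ : ℝ) + 1) • cliffordLM ε e γ (wedgeLM B (ℓ + 1) Z w) =
      γ Z * cliffordLM ε e γ w -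
        ∑ a, sgn (ε a) • (γ (e a) * cliffordLM ε e γ (wedgeLM B ℓ Z (contract (e a) w))) := by
  rw [cliffordLM_succ, ← h.sum_smul_map γ Z, Finset.sum_mul, ← Finset.sum_sub_distrib]
  refine Finset.sum_congr rfl fun a _ => ?_
  rw [curryLeft_wedgeLM, h.symm Z, map_sub, map_smul, mul_sub, mul_smul_comm, smul_mul_assoc]
  module

theorem IsCliffordMap.sum_mul_mul_cliffordLM (h : IsOrthonormalFrame ε e B)
    (hγ : IsCliffordMap B γ) (w : T [⋀^Fin (ℓ + 1)]→ₗ[ℝ] 𝕜) (Z : T) :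
    ∑ a, sgn (ε a) • (γ (e a) * (γ Z * 𝔠 (w.curryLeft (e a)))) =
      (-2 : ℝ) • 𝔠 (w.curryLeft Z) - ((ℓ : ℝ) + 1) • (γ Z * 𝔠 w) := by
  have hswap (a : Fin n) : γ (e a) * (γ Z * 𝔠 (w.curryLeft (e a))) =
      (-2 * B (e a) Z) • 𝔠 (w.curryLeft (e a)) - γ Z * (γ (e a) * 𝔠 (w.curryLeft (e a))) := by
    rw [← mul_assoc, eq_sub_of_add_eq (hγ (e a) Z), sub_mul, smul_mul_assoc, one_mul, mul_assoc]
  have hexpand := h.sum_smul_map (𝔠 ∘ₗ w.curryLeft) Z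
  rw [LinearMap.comp_apply] at hexpand
  rw [← hexpand, ← mul_smul_comm, cliffordLM_succ, Finset.mul_sum, Finset.smul_sum,
    ← Finset.sum_sub_distrib]
  refine Finset.sum_congr rfl fun a _ => ?_
  rw [hswap, mul_smul_comm, smul_sub, LinearMap.comp_apply]
  module

namespace IsCliffordMap

variable (hγ : IsCliffordMap B γ) (h : IsOrthonormalFrame ε e B)

include hγ h

theorem cliffordLM_mul_eq_smul_add (w : T [⋀^Fin ℓ]→ₗ[ℝ] 𝕜) (Z : T) :
    𝔠 w * γ Z = (-1 : ℝ) ^ ℓ • (γ Z * 𝔠 w + (2 : ℝ) • 𝔠 (contract Z w)) := by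
  induction ℓ with
  | zero => simp [cliffordLM_zero, contract]
  | succ ℓ ih =>
    refine smul_right_injective _ (Nat.cast_add_one_ne_zero ℓ : (ℓ : ℝ) + 1 ≠ 0) ?_
    calc ((ℓ : ℝ) + 1) • (𝔠 w * γ Z)
        = ∑ a, sgn (ε a) • (γ (e a) * (𝔠 (w.curryLeft (e a)) * γ Z)) := by
          simp only [← smul_mul_assoc, cliffordLM_succ, Finset.sum_mul, mul_assoc]
      _ = (-1 : ℝ) ^ ℓ • (∑ a, sgn (ε a) • (γ (e a) * (γ Z * 𝔠 (w.curryLeft (e a)))) +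
            (2 : ℝ) • ∑ a, sgn (ε a) • (γ (e a) * 𝔠 (contract Z (w.curryLeft (e a))))) := by
          simp only [ih, Finset.smul_sum, ← Finset.sum_add_distrib]
          refine Finset.sum_congr rfl fun a _ => ?_
          simp only [mul_smul_comm, mul_add]
          module
      _ = ((ℓ : ℝ) + 1) • (-1 : ℝ) ^ (ℓ + 1) •
            (γ Z * 𝔠 w + (2 : ℝ) • 𝔠 (contract Z w)) := by
          rw [hγ.sum_mul_mul_cliffordLM h, sum_mul_cliffordLM_contract_contract, contract_succ]
          module

theorem mul_cliffordLM (w : T [⋀^Fin ℓ]→ₗ[ℝ] 𝕜) (Z : T) :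
    γ Z * 𝔠 w = 𝔠 (wedgeLM B (ℓ + 1) Z w) - 𝔠 (contract Z w) := by
  induction ℓ with
  | zero => simpa [wedgeLM, contract] using (h.smul_cliffordLM_wedgeLM γ w Z).symm
  | succ ℓ ih =>
    have hℓ : ((ℓ + 1 : ℕ) : ℝ) + 1 ≠ 0 := Nat.cast_add_one_ne_zero _
    have hwedge (a : Fin n) : 𝔠 (wedgeLM B (ℓ + 1) Z (contract (e a) w)) =
        γ Z * 𝔠 (w.curryLeft (e a)) + 𝔠 (contract Z (w.curryLeft (e a))) :=
      sub_eq_iff_eq_add.1 (ih (w.curryLeft (e a))).symm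
    rw [eq_sub_iff_add_eq]
    refine smul_right_injective _ hℓ ?_
    refine Eq.trans ?_ (h.smul_cliffordLM_wedgeLM γ w Z).symm
    simp only [hwedge, mul_add, smul_add, Finset.sum_add_distrib]
    rw [hγ.sum_mul_mul_cliffordLM h, sum_mul_cliffordLM_contract_contract, contract_succ]
    push_cast
    module

theorem cliffordLM_mul_add_mul (w : T [⋀^Fin ℓ]→ₗ[ℝ] 𝕜) (Z : T) :
    𝔠 w * γ Z + (-1 : ℝ) ^ ℓ • (γ Z * 𝔠 w) =
      (2 * (-1 : ℝ) ^ ℓ) • 𝔠 (wedgeLM B (ℓ + 1) Z w) := by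
  rw [hγ.cliffordLM_mul_eq_smul_add h, hγ.mul_cliffordLM h]
  module

theorem cliffordLM_mul_sub_mul (w : T [⋀^Fin ℓ]→ₗ[ℝ] 𝕜) (Z : T) :
    𝔠 w * γ Z - (-1 : ℝ) ^ ℓ • (γ Z * 𝔠 w) = (2 * (-1 : ℝ) ^ ℓ) • 𝔠 (contract Z w) := by
  rw [hγ.cliffordLM_mul_eq_smul_add h]
  module

theorem cliffordLM_injective [Nontrivial S] :
    Function.Injective (𝔠 : (T [⋀^Fin ℓ]→ₗ[ℝ] 𝕜) →ₗ[ℝ] Module.End 𝕜 S) := by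
  rw [injective_iff_map_eq_zero]
  intro w hw
  induction ℓ with
  | zero =>
    rw [cliffordLM_zero, smul_eq_zero_iff_left one_ne_zero] at hw
    ext v
    rw [Subsingleton.elim v ![], hw, AlternatingMap.zero_apply]
  | succ ℓ ih =>
    have hcurry (Z : T) : w.curryLeft Z = 0 := by
      have hcomm := hγ.cliffordLM_mul_sub_mul h w Z
      rw [hw, zero_mul, mul_zero, smul_zero, sub_zero] at hcomm
      exact ih _ ((smul_eq_zero.1 hcomm.symm).resolve_left (by simp))
    ext v
    rw [← Matrix.cons_head_tail v, ← curryLeft_apply_apply, hcurry, AlternatingMap.zero_apply,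
      AlternatingMap.zero_apply]

theorem cliffordLM_mul_add_mul_eq_zero_iff [Nontrivial S] (w : T [⋀^Fin ℓ]→ₗ[ℝ] 𝕜) (Z : T) :
    𝔠 w * γ Z + (-1 : ℝ) ^ ℓ • (γ Z * 𝔠 w) = 0 ↔ wedgeLM B (ℓ + 1) Z w = 0 := by
  rw [hγ.cliffordLM_mul_add_mul h, smul_eq_zero_iff_right (by simp),
    map_eq_zero_iff _ (hγ.cliffordLM_injective h)]

theorem cliffordLM_mul_sub_mul_eq_zero_iff [Nontrivial S] (w : T [⋀^Fin ℓ]→ₗ[ℝ] 𝕜) (Z : T) :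
    𝔠 w * γ Z - (-1 : ℝ) ^ ℓ • (γ Z * 𝔠 w) = 0 ↔ contract Z w = 0 := by
  rw [hγ.cliffordLM_mul_sub_mul h, smul_eq_zero_iff_right (by simp),
    map_eq_zero_iff _ (hγ.cliffordLM_injective h)]

theorem forall_cliffordLM_mul_add_eq_zero_iff [Nontrivial S] (hℓ : ℓ ≠ n + 1)
    {α A₀ : T →ₗ[ℝ] T [⋀^Fin ℓ]→ₗ[ℝ] 𝕜} {F : T [⋀^Fin (ℓ + 1)]→ₗ[ℝ] 𝕜}
    {G : T [⋀^Fin (ℓ - 1)]→ₗ[ℝ] 𝕜} (hd : IsFormDecomposition ε e B α F G A₀) (s : ℤˣ) :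
    (∀ Z, 𝔠 (α Z) * γ Z + sgn s • (γ Z * 𝔠 (α Z)) = 0) ↔
      A₀ = 0 ∧ (F ≠ 0 → s = -(-1) ^ ℓ) ∧ (G ≠ 0 → s = (-1) ^ ℓ) := by
  have hsgn : sgn ((-1) ^ ℓ) = (-1) ^ ℓ := by simp [sgn]
  have hne (t : ℤˣ) : t ≠ -t := Int.units_ne_iff_eq_neg.2 (neg_neg t).symm
  rcases eq_or_ne s ((-1) ^ ℓ) with rfl | hs
  · simp only [hsgn, hγ.cliffordLM_mul_add_mul_eq_zero_iff h]
    rw [hd.forall_wedgeLM_self_eq_zero_iff h hℓ]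
    simp [hne]
  · obtain rfl := Int.units_ne_iff_eq_neg.1 hs
    have hsgn_neg : sgn (-(-1) ^ ℓ) = -(-1) ^ ℓ := by simp [sgn]
    simp only [hsgn_neg, neg_smul, ← sub_eq_add_neg, hγ.cliffordLM_mul_sub_mul_eq_zero_iff h]
    rw [hd.forall_contract_self_eq_zero_iff h hℓ]
    simp [(hne _).symm]

theorem sum_cliffordLM_curryLeft_mul (w : T [⋀^Fin (ℓ + 1)]→ₗ[ℝ] 𝕜) :
    ∑ a, sgn (ε a) • (𝔠 (w.curryLeft (e a)) * γ (e a)) = (-1 : ℝ) ^ ℓ • ((ℓ : ℝ) + 1) • 𝔠 w := by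
  have hcomm (a : Fin n) :
      𝔠 (w.curryLeft (e a)) * γ (e a) = (-1 : ℝ) ^ ℓ • (γ (e a) * 𝔠 (w.curryLeft (e a))) := by
    have hcontract : contract (e a) (w.curryLeft (e a)) = 0 := contract_contract_self (e a) w
    rw [hγ.cliffordLM_mul_eq_smul_add h, hcontract, map_zero, smul_zero, add_zero]
  simp only [hcomm, smul_comm _ ((-1 : ℝ) ^ ℓ), ← Finset.smul_sum, cliffordLM_succ]

theorem bilinForm_cliffordLM_apply {b : LinearMap.BilinForm 𝕜 S} {d₀ d₁ : ℤˣ}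
    (hb : ∀ X φ ψ, b φ (γ X ψ) = sgn (d₀ * d₁) • b (γ X φ) ψ) (w : T [⋀^Fin ℓ]→ₗ[ℝ] 𝕜) (φ ψ : S) :
    b φ (𝔠 w ψ) = sgn (d₀ * Delta d₀ d₁ ℓ) • b (𝔠 w φ) ψ := by
  have hsmul (r : ℝ) (φ ψ : S) : b (r • φ) ψ = r • b φ ψ := by
    rw [LinearMap.map_smul_of_tower, LinearMap.smul_apply]
  induction ℓ generalizing φ ψ with
  | zero => simp [cliffordLM_zero, Delta_zero, sgn]
  | succ ℓ ih =>
    have hsign : sgn (d₀ * Delta d₀ d₁ (ℓ + 1)) =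
        sgn (d₀ * d₁) * sgn (d₀ * Delta d₀ d₁ ℓ) * (-1) ^ ℓ := by
      rw [Delta_add_one]
      simp only [sgn, Units.val_mul, Int.cast_mul, zpow_natCast, Units.val_pow_eq_pow_val,
        Units.val_neg, Units.val_one, Int.cast_pow, Int.cast_neg, Int.cast_one]
      ring
    refine smul_right_injective _ (Nat.cast_add_one_ne_zero ℓ : (ℓ : ℝ) + 1 ≠ 0) ?_
    calc ((ℓ : ℝ) + 1) • b φ (𝔠 w ψ)
        = ∑ a, sgn (ε a) • b φ (γ (e a) (𝔠 (w.curryLeft (e a)) ψ)) := by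
          rw [← LinearMap.map_smul_of_tower, ← LinearMap.smul_apply, cliffordLM_succ]
          simp only [LinearMap.sum_apply, LinearMap.smul_apply, map_sum,
            LinearMap.map_smul_of_tower, Module.End.mul_apply]
      _ = (sgn (d₀ * d₁) * sgn (d₀ * Delta d₀ d₁ ℓ)) •
            ∑ a, sgn (ε a) • b (𝔠 (w.curryLeft (e a)) (γ (e a) φ)) ψ := by
          rw [Finset.smul_sum]
          refine Finset.sum_congr rfl fun a _ => ?_
          rw [hb, ih]
          module
      _ = (sgn (d₀ * d₁) * sgn (d₀ * Delta d₀ d₁ ℓ)) •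
            (-1 : ℝ) ^ ℓ • ((ℓ : ℝ) + 1) • b (𝔠 w φ) ψ := by
          have hsum := congrArg (fun Φ : Module.End 𝕜 S => b (Φ φ) ψ)
            (hγ.sum_cliffordLM_curryLeft_mul h w)
          simp only [LinearMap.sum_apply, LinearMap.smul_apply, map_sum, hsmul,
            Module.End.mul_apply] at hsum
          rw [hsum]
      _ = ((ℓ : ℝ) + 1) • sgn (d₀ * Delta d₀ d₁ (ℓ + 1 : ℕ)) • b (𝔠 w φ) ψ := by
          rw [Nat.cast_succ, hsign]
          module

end IsCliffordMap

end CliffordAction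

/-! ### Differentiability in moving frames -/

section Frames

open Bundle ContinuousLinearMap

variable {𝕜 : Type*} [NontriviallyNormedField 𝕜] [CompleteSpace 𝕜]
  {E : Type*} [NormedAddCommGroup E] [NormedSpace 𝕜 E]
  {H : Type*} [TopologicalSpace H] {I : ModelWithCorners 𝕜 E H}
  {M : Type*} [TopologicalSpace M] [ChartedSpace H M] {x : M}
  {F : Type*} [NormedAddCommGroup F] [NormedSpace 𝕜 F]
  {F' : Type*} [NormedAddCommGroup F'] [NormedSpace 𝕜 F'] [FiniteDimensional 𝕜 F']

theorem mdifferentiableAt_clm_of_forall_apply {P : M → F' →L[𝕜] F}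
    (hP : ∀ ψ, MDifferentiableAt I 𝓘(𝕜, F) (fun y => P y ψ) x) :
    MDifferentiableAt I 𝓘(𝕜, F' →L[𝕜] F) P x := by
  let b := Module.finBasis 𝕜 F'
  have hsum : P = ∑ i, fun y =>
      smulRightL 𝕜 F' F (LinearMap.toContinuousLinearMap (b.coord i)) (P y (b i)) := by
    ext1 y
    refine coe_injective (b.ext fun j => ?_)
    simp [Finsupp.single_apply]
  rw [hsum]
  exact MDifferentiableAt.sum fun i _ =>
    (smulRightL 𝕜 F' F _).differentiableAt.comp_mdifferentiableAt (hP (b i))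

theorem mdifferentiableAt_inverse_of_forall_apply {P : M → F' →L[𝕜] F}
    (hP : ∀ ψ, MDifferentiableAt I 𝓘(𝕜, F) (fun y => P y ψ) x) (hx : (P x).IsInvertible) :
    MDifferentiableAt I 𝓘(𝕜, F →L[𝕜] F') (fun y => (P y).inverse) x := by
  have : CompleteSpace F' := FiniteDimensional.complete 𝕜 F'
  obtain ⟨N, hN⟩ := hx
  have hinv : DifferentiableAt 𝕜 (inverse : (F' →L[𝕜] F) → F →L[𝕜] F') (P x) :=
    hN ▸ (contDiffAt_map_inverse (n := 1) N).differentiableAt one_ne_zero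
  exact hinv.comp_mdifferentiableAt (mdifferentiableAt_clm_of_forall_apply hP)

variable {V : M → Type*} [TopologicalSpace (TotalSpace F V)]
  [∀ x, AddCommGroup (V x)] [∀ x, Module 𝕜 (V x)] [∀ x, TopologicalSpace (V x)]
  [FiberBundle F V] [VectorBundle 𝕜 F V] {θ : Π y, F' ≃ₗ[𝕜] V y}

theorem mdifferentiableAt_frame_apply (hθ : ∀ ψ, MDiffAt (T% (fun y => θ y ψ)) x) {u : M → F'}
    (hu : MDifferentiableAt I 𝓘(𝕜, F') u x) : MDiffAt (T% (fun y => θ y (u y))) x := by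
  let b := Module.finBasis 𝕜 F'
  have hsum (y : M) : θ y (u y) = ∑ i, b.coord i (u y) • θ y (b i) := by
    conv_lhs => rw [← b.sum_repr (u y), map_sum]
    simp only [map_smul, Module.Basis.coord_apply]
  simp only [hsum]
  refine MDifferentiableAt.sum_section fun i _ =>
    MDifferentiableAt.smul_section (f := fun y => b.coord i (u y)) ?_ (hθ (b i))
  exact (LinearMap.toContinuousLinearMap (b.coord i)).differentiableAt.comp_mdifferentiableAt hu

variable [ContMDiffVectorBundle 1 F V I]

theorem mdifferentiableAt_frame_symm_apply (hθ : ∀ ψ, MDiffAt (T% (fun y => θ y ψ)) x)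
    {ξ : Π y, V y} (hξ : MDiffAt (T% ξ) x) :
    MDifferentiableAt I 𝓘(𝕜, F') (fun y => (θ y).symm (ξ y)) x := by
  let t := trivializationAt F V x
  have hx : x ∈ t.baseSet := mem_baseSet_trivializationAt F V x
  have hnhds : ∀ᶠ y in nhds x, y ∈ t.baseSet := t.open_baseSet.mem_nhds hx
  let P (y : M) : F' →L[𝕜] F :=
    LinearMap.toContinuousLinearMap (t.linearMapAt 𝕜 y ∘ₗ (θ y : F' →ₗ[𝕜] V y))
  let N (y : M) (hy : y ∈ t.baseSet) : F' ≃L[𝕜] F :=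
    ((θ y).trans (t.linearEquivAt 𝕜 y hy)).toContinuousLinearEquiv
  have hN (y : M) (hy : y ∈ t.baseSet) : P y = N y hy := by
    ext ψ
    simp [P, N, t.coe_linearMapAt_of_mem hy]
  have hP (ψ : F') : MDifferentiableAt I 𝓘(𝕜, F) (fun y => P y ψ) x := by
    refine ((t.mdifferentiableAt_section_iff I _ hx).1 (hθ ψ)).congr_of_eventuallyEq ?_
    filter_upwards [hnhds] with y hy
    simp [P, t.coe_linearMapAt_of_mem hy]
  have hinv := mdifferentiableAt_inverse_of_forall_apply hP ⟨N x hx, (hN x hx).symm⟩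
  refine (hinv.clm_apply ((t.mdifferentiableAt_section_iff I _ hx).1 hξ)).congr_of_eventuallyEq ?_
  filter_upwards [hnhds] with y hy
  rw [hN y hy, inverse_equiv, ContinuousLinearEquiv.coe_coe, ContinuousLinearEquiv.eq_symm_apply]
  simp [N]

end Frames

/-! ### Parallel bilinear maps -/

section LeibnizDefect

open Bundle

variable {𝕜 : Type*} [NontriviallyNormedField 𝕜]
  {E : Type*} [NormedAddCommGroup E] [NormedSpace 𝕜 E]
  {H : Type*} [TopologicalSpace H] {I : ModelWithCorners 𝕜 E H}
  {M : Type*} [TopologicalSpace M] [ChartedSpace H M]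
  {F₁ : Type*} [NormedAddCommGroup F₁] [NormedSpace 𝕜 F₁]
  {V₁ : M → Type*} [TopologicalSpace (TotalSpace F₁ V₁)]
  [∀ x, AddCommGroup (V₁ x)] [∀ x, Module 𝕜 (V₁ x)] [∀ x, TopologicalSpace (V₁ x)]
  [∀ x, IsTopologicalAddGroup (V₁ x)] [∀ x, ContinuousSMul 𝕜 (V₁ x)] [FiberBundle F₁ V₁]
  {F₂ : Type*} [NormedAddCommGroup F₂] [NormedSpace 𝕜 F₂]
  {V₂ : M → Type*} [TopologicalSpace (TotalSpace F₂ V₂)]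
  [∀ x, AddCommGroup (V₂ x)] [∀ x, Module 𝕜 (V₂ x)] [∀ x, TopologicalSpace (V₂ x)]
  [∀ x, IsTopologicalAddGroup (V₂ x)] [∀ x, ContinuousSMul 𝕜 (V₂ x)] [FiberBundle F₂ V₂]
  {F₃ : Type*} [NormedAddCommGroup F₃] [NormedSpace 𝕜 F₃]
  {V₃ : M → Type*} [TopologicalSpace (TotalSpace F₃ V₃)]
  [∀ x, AddCommGroup (V₃ x)] [∀ x, Module 𝕜 (V₃ x)] [∀ x, TopologicalSpace (V₃ x)]
  [∀ x, IsTopologicalAddGroup (V₃ x)] [∀ x, ContinuousSMul 𝕜 (V₃ x)] [FiberBundle F₃ V₃]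

/-- The value on sections `X` and `Y` of the covariant derivative `∇_Z μ` at `x` of a field `μ` of
bilinear maps, `∇_Z (μ(X, Y)) - μ(∇_Z X, Y) - μ(X, ∇_Z Y)`. -/
def leibnizDefect (cov₁ : CovariantDerivative I F₁ V₁) (cov₂ : CovariantDerivative I F₂ V₂)
    (cov₃ : CovariantDerivative I F₃ V₃) (μ : Π x, V₁ x →ₗ[𝕜] V₂ x →ₗ[𝕜] V₃ x) {x : M}
    (Z : TangentSpace I x) (X : Π y, V₁ y) (Y : Π y, V₂ y) : V₃ x :=
  cov₃ (fun y => μ y (X y) (Y y)) x Z - μ x (cov₁ X x Z) (Y x) - μ x (X x) (cov₂ Y x Z)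

variable (cov₁ : CovariantDerivative I F₁ V₁) (cov₂ : CovariantDerivative I F₂ V₂)
  (cov₃ : CovariantDerivative I F₃ V₃) {μ : Π x, V₁ x →ₗ[𝕜] V₂ x →ₗ[𝕜] V₃ x} {x : M}

theorem leibnizDefect_flip (Z : TangentSpace I x) (X : Π y, V₁ y) (Y : Π y, V₂ y) :
    leibnizDefect cov₂ cov₁ cov₃ (fun y => (μ y).flip) Z Y X =
      leibnizDefect cov₁ cov₂ cov₃ μ Z X Y :=
  sub_right_comm _ _ _

theorem tensorialAt_leibnizDefect_left {Y : Π y, V₂ y}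
    (hμ : ∀ X : Π y, V₁ y, MDiffAt (T% X) x → MDiffAt (T% (fun y => μ y (X y) (Y y))) x)
    (Z : TangentSpace I x) :
    TensorialAt I F₁ (leibnizDefect cov₁ cov₂ cov₃ μ Z · Y) x where
  smul {f X} hf hX := by
    have hsmul : (fun y => μ y ((f • X) y) (Y y)) = f • fun y => μ y (X y) (Y y) := by
      ext y
      simp
    simp only [leibnizDefect, hsmul, cov₃.isCovariantDerivativeOnUniv.leibniz (hμ X hX) hf,
      cov₁.isCovariantDerivativeOnUniv.leibniz hX hf]
    simp only [add_apply, smul_apply, ContinuousLinearMap.smulRight_apply, map_add, map_smul,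
      LinearMap.add_apply, LinearMap.smul_apply, add_sub_add_right_eq_sub, Pi.smul_apply']
    module
  add {X X'} hX hX' := by
    have hadd : (fun y => μ y ((X + X') y) (Y y)) =
        (fun y => μ y (X y) (Y y)) + fun y => μ y (X' y) (Y y) := by
      ext y
      simp
    simp only [leibnizDefect, hadd,
      cov₃.isCovariantDerivativeOnUniv.add (hμ X hX) (hμ X' hX'),
      cov₁.isCovariantDerivativeOnUniv.add hX hX']
    simp only [add_apply, map_add, LinearMap.add_apply, Pi.add_apply]
    abel

variable [CompleteSpace 𝕜] [VectorBundle 𝕜 F₁ V₁] [VectorBundle 𝕜 F₂ V₂]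
  [FiniteDimensional 𝕜 F₁] [FiniteDimensional 𝕜 F₂]
  [ContMDiffVectorBundle 1 F₁ V₁ I] [ContMDiffVectorBundle 1 F₂ V₂ I]

theorem leibnizDefect_congr
    (hμ : ∀ (X : Π y, V₁ y) (Y : Π y, V₂ y), MDiffAt (T% X) x → MDiffAt (T% Y) x →
      MDiffAt (T% (fun y => μ y (X y) (Y y))) x)
    (Z : TangentSpace I x) {X X' : Π y, V₁ y} {Y Y' : Π y, V₂ y}
    (hX : MDiffAt (T% X) x) (hX' : MDiffAt (T% X') x)
    (hY : MDiffAt (T% Y) x) (hY' : MDiffAt (T% Y') x) (hXX' : X x = X' x) (hYY' : Y x = Y' x) :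
    leibnizDefect cov₁ cov₂ cov₃ μ Z X Y = leibnizDefect cov₁ cov₂ cov₃ μ Z X' Y' := by
  refine TensorialAt.pointwise₂
    (fun Y hY => tensorialAt_leibnizDefect_left cov₁ cov₂ cov₃ (hμ · Y · hY) Z)
    (fun X hX => ?_) hX hX' hY hY' hXX' hYY'
  simp only [← leibnizDefect_flip cov₁ cov₂ cov₃]
  exact tensorialAt_leibnizDefect_left cov₂ cov₁ cov₃ (hμ X · hX) Z

end LeibnizDefect

/-! ### Lifting skew endomorphisms to spinors -/

section SpinLift

variable {𝕜 : Type*} [RCLike 𝕜] {T : Type*} [AddCommGroup T] [Module ℝ T]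
  {S : Type*} [AddCommGroup S] [Module ℝ S] [Module 𝕜 S] [IsScalarTower ℝ 𝕜 S]
  {n : ℕ} {ε : Fin n → ℤˣ} {e w : Fin n → T} {B : T →ₗ[ℝ] T →ₗ[ℝ] ℝ}
  {γ : T →ₗ[ℝ] Module.End 𝕜 S} {X Y : T}

theorem IsCliffordMap.mul_mul_sub_mul_mul (hγ : IsCliffordMap B γ) (V W X : T) :
    γ V * γ W * γ X - γ X * (γ V * γ W) = (2 * B V X) • γ W - (2 * B W X) • γ V := by
  have hV := congrArg (· * γ W) (hγ V X)
  have hW := congrArg (γ V * ·) (hγ W X)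
  simp only [mul_add, add_mul, mul_smul_comm, smul_mul_assoc, mul_one, one_mul] at hV hW
  calc γ V * γ W * γ X - γ X * (γ V * γ W)
      = (γ V * (γ W * γ X) + γ V * (γ X * γ W)) -
          (γ V * γ X * γ W + γ X * γ V * γ W) := by noncomm_ring
    _ = (2 * B V X) • γ W - (2 * B W X) • γ V := by
      rw [hV, hW]
      module

theorem IsOrthonormalFrame.sum_sum_smul_of_skew (h : IsOrthonormalFrame ε e B)
    (hw : ∀ a b, B (w a) (e b) = -B (w b) (e a)) (hX : ∀ b, B Y (e b) = -B (w b) X) :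
    ∑ b, ∑ a, (sgn (ε a) * sgn (ε b) * B (w a) (e b) * B (e a) X) • γ (e b) = γ Y := by
  rw [← h.sum_smul_map γ Y]
  refine Finset.sum_congr rfl fun b _ => ?_
  rw [h.symm (e b) Y, hX, ← h.sum_smul_map (B (w b)) X, ← Finset.sum_smul,
    ← Finset.sum_neg_distrib, Finset.mul_sum]
  congr! 2 with a
  rw [hw a b, smul_eq_mul]
  ring

/-- The commutator of the spin connection form with Clifford multiplication, for a skew
endomorphism which maps `e_a` to `w_a` and `X` to `Y`. -/
theorem IsOrthonormalFrame.sum_commutator (h : IsOrthonormalFrame ε e B)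
    (hγ : IsCliffordMap B γ) (hw : ∀ a b, B (w a) (e b) = -B (w b) (e a))
    (hX : ∀ b, B Y (e b) = -B (w b) X) :
    (1 / 4 : ℝ) • ∑ a, ∑ b, (sgn (ε a) * sgn (ε b) * B (w a) (e b)) •
      (γ (e a) * γ (e b) * γ X - γ X * (γ (e a) * γ (e b))) = γ Y := by
  have hsum := h.sum_sum_smul_of_skew (γ := γ) hw hX
  have hleft : ∑ a, ∑ b, (sgn (ε a) * sgn (ε b) * B (w a) (e b) * (2 * B (e a) X)) • γ (e b) =
      (2 : ℝ) • γ Y := by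
    rw [← hsum, Finset.sum_comm]
    simp only [Finset.smul_sum, smul_smul]
    congr! 3
    ring
  have hright : ∑ a, ∑ b, (sgn (ε a) * sgn (ε b) * B (w a) (e b) * (2 * B (e b) X)) • γ (e a) =
      -(2 : ℝ) • γ Y := by
    rw [← hsum]
    simp only [Finset.smul_sum, smul_smul]
    congr! 3 with a _ b
    rw [hw a b]
    ring
  simp only [hγ.mul_mul_sub_mul_mul, smul_sub, smul_smul, Finset.sum_sub_distrib, hleft, hright]
  module

end SpinLift

/-! ### Spinor bundles -/

section SpinBundle

variable {𝕜 : Type*} [RCLike 𝕜]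
  {E : Type*} [NormedAddCommGroup E] [NormedSpace ℝ E]
  {M : Type*} [TopologicalSpace M] [ChartedSpace E M] [IsManifold 𝓘(ℝ, E) ∞ M]
  {F : Type*} [NormedAddCommGroup F] [NormedSpace ℝ F] [NormedSpace 𝕜 F] [IsScalarTower ℝ 𝕜 F]
  {n : ℕ} {ε : Fin n → ℤˣ}
  {S : M → Type*} [TopologicalSpace (Bundle.TotalSpace F S)]
  [∀ x, AddCommGroup (S x)] [∀ x, Module 𝕜 (S x)] [∀ x, TopologicalSpace (S x)]
  [FiberBundle F S]
  {g : PseudoRiemannianMetric E M} {ρ : SpinorModule 𝕜 F ε}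

theorem modelInner_single_left (ε : Fin n → ℤˣ) (a : Fin n) (v : Fin n → ℝ) :
    modelInner ε (Pi.single a 1) v = sgn (ε a) * v a := by
  rw [modelInner, Finset.sum_eq_single a (fun b _ hb => by simp [hb]) (by simp)]
  simp

theorem ι_mul_ι_add_swap (v w : Fin n → ℝ) :
    CliffordAlgebra.ι (cliffordForm ε) v * CliffordAlgebra.ι (cliffordForm ε) w +
      CliffordAlgebra.ι (cliffordForm ε) w * CliffordAlgebra.ι (cliffordForm ε) v =
      algebraMap ℝ _ (-2 * modelInner ε v w) := by
  rw [CliffordAlgebra.ι_mul_ι_add_swap]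
  congr 1
  simp only [QuadraticMap.polar, cliffordForm, QuadraticMap.weightedSumSquares_apply, modelInner,
    Pi.add_apply, smul_eq_mul]
  rw [← Finset.sum_sub_distrib, ← Finset.sum_sub_distrib, Finset.mul_sum]
  exact Finset.sum_congr rfl fun a _ => by ring

namespace SpinStructure

variable (σ : SpinStructure (𝕜 := 𝕜) S g ρ) {x : M}

theorem metric_apply (X Y : TangentSpace 𝓘(ℝ, E) x) : metric g x X Y = g.inner x X Y := rfl

theorem isOrthonormalFrame {p : FramePair 𝕜 (E := E) F n S x} (hp : p ∈ σ.P x) :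
    IsOrthonormalFrame ε (fun a => p.1 (Pi.single a 1)) (metric g x) where
  symm := g.symm x
  norm a := by
    rw [metric_apply, σ.orthonormal hp, modelInner_single_left]
    simp
  expand X := by
    obtain ⟨v, rfl⟩ := p.1.surjective X
    have hcoord (a : Fin n) : sgn (ε a) * metric g x (p.1 (Pi.single a 1)) (p.1 v) = v a := by
      rw [metric_apply, σ.orthonormal hp, modelInner_single_left, ← mul_assoc, sgn_mul_self,
        one_mul]
    simp only [hcoord, ← map_smul, ← map_sum]
    exact congrArg p.1 (pi_eq_sum_univ' v).symm

theorem isOrthonormalFrame_e (x : M) : IsOrthonormalFrame ε (σ.e x) (metric g x) :=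
  σ.isOrthonormalFrame (σ.framePair_mem x)

include σ in
theorem nontrivial_fiber [FiniteDimensional 𝕜 F] (x : M) : Nontrivial (S x) :=
  have : Nontrivial F :=
    Module.nontrivial_of_finrank_pos (R := 𝕜) (by rw [ρ.finrank_eq]; positivity)
  (σ.framePair x).2.symm.toEquiv.nontrivial

variable [∀ x, Module ℝ (S x)] [∀ x, IsScalarTower ℝ 𝕜 (S x)]

/-- Clifford multiplication `SpinStructure.gamma` as a linear map. -/
def gammaLM (x : M) : TangentSpace 𝓘(ℝ, E) x →ₗ[ℝ] Module.End 𝕜 (S x) where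
  toFun := σ.gamma x
  map_add' X Y := by simp [gamma]
  map_smul' r X := by
    ext ψ
    simp only [gamma, map_smul, RingHom.id_apply, LinearMap.smul_apply,
      LinearEquiv.conj_apply_apply]
    exact LinearMap.map_smul_of_tower (σ.framePair x).2.toLinearMap r _

theorem gammaLM_apply (X : TangentSpace 𝓘(ℝ, E) x) : σ.gammaLM x X = σ.gamma x X := rfl

theorem isCliffordMap_gammaLM (x : M) : IsCliffordMap (metric g x) (σ.gammaLM x) := by
  intro X Y
  obtain ⟨v, rfl⟩ := (σ.framePair x).1.surjective X
  obtain ⟨w, rfl⟩ := (σ.framePair x).1.surjective Y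
  ext ξ
  obtain ⟨ψ, rfl⟩ := (σ.framePair x).2.surjective ξ
  have hp := σ.framePair_mem x
  have hact : ρ.act (CliffordAlgebra.ι _ v) (ρ.act (CliffordAlgebra.ι _ w) ψ) +
      ρ.act (CliffordAlgebra.ι _ w) (ρ.act (CliffordAlgebra.ι _ v) ψ) =
      (-2 * modelInner ε v w) • ψ := by
    rw [← Module.algebraMap_end_apply (S := 𝕜), ← AlgHom.commutes ρ.act, ← ι_mul_ι_add_swap,
      map_add, map_mul, map_mul]
    rfl
  have hframe := LinearMap.map_smul_of_tower (σ.framePair x).2.toLinearMap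
    (-2 * modelInner ε v w) ψ
  rw [← hact, map_add] at hframe
  simp only [LinearMap.add_apply, Module.End.mul_apply, gammaLM_apply, σ.gamma_apply hp,
    metric_apply, σ.orthonormal hp, LinearMap.smul_apply, Module.End.one_apply]
  exact hframe

theorem ofForm_eq (x : M) {ℓ : ℕ} (w : TangentSpace 𝓘(ℝ, E) x [⋀^Fin ℓ]→ₗ[ℝ] 𝕜) :
    σ.ofForm x w = cliffordLM ε (σ.e x) (σ.gammaLM x) w := rfl

theorem ofForm_injective [FiniteDimensional 𝕜 F] (x : M) {ℓ : ℕ} :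
    Function.Injective (σ.ofForm x (ℓ := ℓ)) :=
  have := σ.nontrivial_fiber x
  (σ.isCliffordMap_gammaLM x).cliffordLM_injective (σ.isOrthonormalFrame_e x)

theorem form_gammaLM (C : ChargeConjugation ρ) (x : M) (X : TangentSpace 𝓘(ℝ, E) x)
    (φ ψ : S x) :
    σ.form C x φ (σ.gammaLM x X ψ) = sgn (C.Δ₀ * C.Δ₁) • σ.form C x (σ.gammaLM x X φ) ψ := by
  obtain ⟨v, rfl⟩ := (σ.framePair x).1.surjective X
  obtain ⟨φ, rfl⟩ := (σ.framePair x).2.surjective φ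
  obtain ⟨ψ, rfl⟩ := (σ.framePair x).2.surjective ψ
  have hp := σ.framePair_mem x
  rw [gammaLM_apply, σ.gamma_apply hp, σ.gamma_apply hp, σ.form_apply C hp, σ.form_apply C hp,
    C.form_act_ι, ← Int.cast_smul_eq_zsmul ℝ, smul_smul]
  exact (by rw [sgn_mul_self, one_smul] : (sgn _ * sgn _) • _ = _).symm

section Adjoint

variable [FiniteDimensional 𝕜 F] (C : ChargeConjugation ρ)

omit [∀ x, Module ℝ (S x)] [∀ x, IsScalarTower ℝ 𝕜 (S x)] in
theorem adjoint_eq_of_form_eq {Φ Ψ : Module.End 𝕜 (S x)}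
    (h : ∀ η ξ, σ.form C x (Ψ η) ξ = σ.form C x η (Φ ξ)) : σ.adjoint C x Φ = Ψ := by
  have hnd : (σ.form C x).Nondegenerate := C.nondegenerate.congr _
  ext η
  refine sub_eq_zero.1 (hnd.1 _ fun ξ => ?_)
  rw [map_sub, LinearMap.sub_apply, σ.form_adjoint, h, sub_self]

omit [∀ x, Module ℝ (S x)] [∀ x, IsScalarTower ℝ 𝕜 (S x)] in
theorem adjoint_add (Φ Ψ : Module.End 𝕜 (S x)) :
    σ.adjoint C x (Φ + Ψ) = σ.adjoint C x Φ + σ.adjoint C x Ψ :=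
  σ.adjoint_eq_of_form_eq C fun η ξ => by
    simp only [LinearMap.add_apply, map_add, σ.form_adjoint]

theorem adjoint_ofForm {ℓ : ℕ} (w : TangentSpace 𝓘(ℝ, E) x [⋀^Fin ℓ]→ₗ[ℝ] 𝕜) :
    σ.adjoint C x (σ.ofForm x w) = sgn (C.Δ₀ * C.Δ ℓ) • σ.ofForm x w :=
  σ.adjoint_eq_of_form_eq C fun η ξ => by
    rw [ofForm_eq, (σ.isCliffordMap_gammaLM x).bilinForm_cliffordLM_apply
      (σ.isOrthonormalFrame_e x) (σ.form_gammaLM C x), LinearMap.smul_apply,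
      LinearMap.map_smul_of_tower, LinearMap.smul_apply]
    rfl

end Adjoint

end SpinStructure

end SpinBundle

/-! ### Clifford multiplication is parallel -/

section Parallel

variable {𝕜 : Type*} [RCLike 𝕜]
  {E : Type*} [NormedAddCommGroup E] [NormedSpace ℝ E]
  {M : Type*} [TopologicalSpace M] [ChartedSpace E M] [IsManifold 𝓘(ℝ, E) ∞ M]
  {F : Type*} [NormedAddCommGroup F] [NormedSpace ℝ F] [NormedSpace 𝕜 F] [IsScalarTower ℝ 𝕜 F]
  {n : ℕ} {ε : Fin n → ℤˣ}
  {S : M → Type*} [TopologicalSpace (Bundle.TotalSpace F S)]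
  [∀ x, AddCommGroup (S x)] [∀ x, Module 𝕜 (S x)] [∀ x, TopologicalSpace (S x)]
  [FiberBundle F S]
  {g : PseudoRiemannianMetric E M} {ρ : SpinorModule 𝕜 F ε}

/-- A connection on the tangent bundle is metric if `Z g(X, Y) = g(∇_Z X, Y) + g(X, ∇_Z Y)`; it may
have torsion. -/
def IsMetricConnection (g : PseudoRiemannianMetric E M)
    (nabla : CovariantDerivative 𝓘(ℝ, E) E (TangentSpace 𝓘(ℝ, E) : M → Type _)) : Prop :=
  ∀ (x : M) (X Y : Π y : M, TangentSpace 𝓘(ℝ, E) y) (Z : TangentSpace 𝓘(ℝ, E) x),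
    MDiffAt (T% X) x → MDiffAt (T% Y) x →
      (mfderiv% (fun y => g.inner y (X y) (Y y)) x Z : ℝ) =
        g.inner x (nabla X x Z) (Y x) + g.inner x (X x) (nabla Y x Z)

namespace SpinStructure

variable (σ : SpinStructure (𝕜 := 𝕜) S g ρ)

theorem exists_isSpinFrame (x : M) : ∃ (U : Set M) (s : Π y : M, FramePair 𝕜 (E := E) F n S y),
    x ∈ U ∧ σ.IsSpinFrame U s :=
  let ⟨U, hU, hx, s, hs, hfst, hsnd⟩ := σ.exists_section x
  ⟨U, s, hx, hU, hs, hfst, hsnd⟩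

section SpinFrame

variable {σ} {U : Set M} {s : Π y : M, FramePair 𝕜 (E := E) F n S y} {x : M}

theorem IsSpinFrame.mdifferentiableAt_fst (hs : σ.IsSpinFrame U s) (hx : x ∈ U) (v : Fin n → ℝ) :
    MDiffAt (T% (fun y => ((s y).1 v : TangentSpace 𝓘(ℝ, E) y))) x :=
  ((hs.contMDiffOn_fst v).contMDiffAt (hs.isOpen.mem_nhds hx)).mdifferentiableAt (by simp)

theorem IsSpinFrame.mdifferentiableAt_snd (hs : σ.IsSpinFrame U s) (hx : x ∈ U) (ψ : F) :
    MDiffAt (T% (fun y => (s y).2 ψ)) x :=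
  ((hs.contMDiffOn_snd ψ).contMDiffAt (hs.isOpen.mem_nhds hx)).mdifferentiableAt (by simp)

theorem IsSpinFrame.inner_nabla_skew (hs : σ.IsSpinFrame U s) (hx : x ∈ U)
    {nabla : CovariantDerivative 𝓘(ℝ, E) E (TangentSpace 𝓘(ℝ, E) : M → Type _)}
    (hnabla : IsMetricConnection g nabla) (Z : TangentSpace 𝓘(ℝ, E) x) (v w : Fin n → ℝ) :
    g.inner x (nabla (fun y => (s y).1 v) x Z) ((s x).1 w) =
      -g.inner x (nabla (fun y => (s y).1 w) x Z) ((s x).1 v) := by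
  have hmetric := hnabla x (fun y => (s y).1 v) (fun y => (s y).1 w) Z
    (hs.mdifferentiableAt_fst hx v) (hs.mdifferentiableAt_fst hx w)
  have hconst : (fun y => g.inner y ((s y).1 v) ((s y).1 w)) =ᶠ[nhds x]
      fun _ => modelInner ε v w := by
    filter_upwards [hs.isOpen.mem_nhds hx] with y hy
    exact σ.orthonormal (hs.mem y hy) v w
  rw [hconst.mfderiv_eq, mfderiv_const] at hmetric
  rw [eq_neg_iff_add_eq_zero, g.symm x _ ((s x).1 v)]
  exact hmetric.symm

end SpinFrame

variable [FiniteDimensional 𝕜 F] [∀ x, Module ℝ (S x)] [∀ x, IsScalarTower ℝ 𝕜 (S x)]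
  [VectorBundle ℝ F S] [ContMDiffVectorBundle ∞ F S 𝓘(ℝ, E)]

theorem mdifferentiableAt_gamma {x : M} {X : Π y : M, TangentSpace 𝓘(ℝ, E) y} {ξ : Π y : M, S y}
    (hX : MDiffAt (T% X) x) (hξ : MDiffAt (T% ξ) x) :
    MDiffAt (T% (fun y => σ.gamma y (X y) (ξ y))) x := by
  have : FiniteDimensional ℝ F := FiniteDimensional.trans ℝ 𝕜 F
  have : ContMDiffVectorBundle 1 F S 𝓘(ℝ, E) := ContMDiffVectorBundle.of_le (n := ∞) (by simp)
  have : IsManifold 𝓘(ℝ, E) 1 M := IsManifold.of_le (n := ∞) (by simp)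
  obtain ⟨U, s, hx, hs⟩ := σ.exists_isSpinFrame x
  let θ (y : M) : F ≃ₗ[ℝ] S y := (s y).2.restrictScalars ℝ
  have hθ : ∀ ψ, MDiffAt (T% (fun y => θ y ψ)) x := hs.mdifferentiableAt_snd hx
  have hv : MDifferentiableAt 𝓘(ℝ, E) 𝓘(ℝ, Fin n → ℝ) (fun y => (s y).1.symm (X y)) x :=
    mdifferentiableAt_frame_symm_apply (hs.mdifferentiableAt_fst hx) hX
  have hψ : MDiffAt (fun y => (θ y).symm (ξ y)) x := mdifferentiableAt_frame_symm_apply hθ hξ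
  let act : (Fin n → ℝ) →L[ℝ] F →L[ℝ] F := LinearMap.toContinuousBilinearMap <|
    LinearMap.restrictScalarsₗ ℝ 𝕜 F F ℝ ∘ₗ ρ.act.toLinearMap ∘ₗ
      CliffordAlgebra.ι (cliffordForm ε)
  have hact : MDiffAt (fun y => act ((s y).1.symm (X y)) ((θ y).symm (ξ y))) x :=
    (act.differentiableAt.comp_mdifferentiableAt hv).clm_apply hψ
  refine (mdifferentiableAt_frame_apply hθ hact).congr_of_eventuallyEq ?_
  filter_upwards [hs.isOpen.mem_nhds hx] with y hy
  have hgamma := σ.gamma_apply (hs.mem y hy) ((s y).1.symm (X y)) ((s y).2.symm (ξ y))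
  rw [LinearEquiv.apply_symm_apply, LinearEquiv.apply_symm_apply] at hgamma
  exact congrArg (Bundle.TotalSpace.mk' F y) hgamma

variable [∀ x, IsTopologicalAddGroup (S x)] [∀ x, ContinuousSMul ℝ (S x)]
  {nabla : CovariantDerivative 𝓘(ℝ, E) E (TangentSpace 𝓘(ℝ, E) : M → Type _)}
  {nablaS : CovariantDerivative 𝓘(ℝ, E) F S}

theorem IsSpinFrame.nabla_gamma {σ : SpinStructure (𝕜 := 𝕜) S g ρ} {U : Set M}
    {s : Π y : M, FramePair 𝕜 (E := E) F n S y} (hs : σ.IsSpinFrame U s) {x : M} (hx : x ∈ U)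
    (hnabla : IsMetricConnection g nabla) (hnablaS : σ.IsSpinLeviCivita nabla nablaS)
    (v : Fin n → ℝ) (ψ : F) (Z : TangentSpace 𝓘(ℝ, E) x) :
    nablaS (fun y => σ.gamma y ((s y).1 v) ((s y).2 ψ)) x Z =
      σ.gamma x (nabla (fun y => (s y).1 v) x Z) ((s x).2 ψ) +
        σ.gamma x ((s x).1 v) (nablaS (fun y => (s y).2 ψ) x Z) := by
  have hgamma : nablaS (fun y => σ.gamma y ((s y).1 v) ((s y).2 ψ)) x =
      nablaS (fun y => (s y).2 (ρ.act (CliffordAlgebra.ι (cliffordForm ε) v) ψ)) x := by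
    refine nablaS.isCovariantDerivativeOnUniv.congr_of_eventuallyEq
      (σ.mdifferentiableAt_gamma (hs.mdifferentiableAt_fst hx v) (hs.mdifferentiableAt_snd hx ψ))
      (hs.mdifferentiableAt_snd hx _) Filter.univ_mem ?_
    filter_upwards [hs.isOpen.mem_nhds hx] with y hy
    exact σ.gamma_apply (hs.mem y hy) v ψ
  have hcomm := (σ.isOrthonormalFrame (hs.mem x hx)).sum_commutator (σ.isCliffordMap_gammaLM x)
    (w := fun a => nabla (fun y => (s y).1 (Pi.single a 1)) x Z) (X := (s x).1 v)
    (Y := nabla (fun y => (s y).1 v) x Z) (fun a b => hs.inner_nabla_skew hx hnabla Z _ _)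
    (fun b => hs.inner_nabla_skew hx hnabla Z _ _)
  have hsmul (Φ : Module.End 𝕜 (S x)) (r : ℝ) (ξ : S x) : Φ (r • ξ) = r • Φ ξ :=
    LinearMap.map_smul_of_tower Φ r ξ
  rw [hgamma, hnablaS U s hs x hx Z, hnablaS U s hs x hx Z, ← σ.gamma_apply (hs.mem x hx),
    ← sub_eq_iff_eq_add]
  refine Eq.trans ?_ (LinearMap.congr_fun hcomm ((s x).2 ψ))
  simp only [LinearMap.smul_apply, LinearMap.sum_apply, LinearMap.sub_apply,
    Module.End.mul_apply, gammaLM_apply, hsmul, map_sum, smul_sub, Finset.sum_sub_distrib,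
    metric_apply]

theorem nabla_gamma [FiniteDimensional ℝ E] (hnabla : IsMetricConnection g nabla)
    (hnablaS : σ.IsSpinLeviCivita nabla nablaS) {x : M} {X : Π y : M, TangentSpace 𝓘(ℝ, E) y}
    {ξ : Π y : M, S y} (hX : MDiffAt (T% X) x) (hξ : MDiffAt (T% ξ) x)
    (Z : TangentSpace 𝓘(ℝ, E) x) :
    nablaS (fun y => σ.gamma y (X y) (ξ y)) x Z =
      σ.gamma x (nabla X x Z) (ξ x) + σ.gamma x (X x) (nablaS ξ x Z) := by
  have : FiniteDimensional ℝ F := FiniteDimensional.trans ℝ 𝕜 F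
  have : ContMDiffVectorBundle 1 F S 𝓘(ℝ, E) := ContMDiffVectorBundle.of_le (n := ∞) (by simp)
  have : IsManifold 𝓘(ℝ, E) 1 M := IsManifold.of_le (n := ∞) (by simp)
  obtain ⟨U, s, hx, hs⟩ := σ.exists_isSpinFrame x
  obtain ⟨v, hv⟩ := (s x).1.surjective (X x)
  obtain ⟨ψ, hψ⟩ := (s x).2.surjective (ξ x)
  let μ (y : M) : TangentSpace 𝓘(ℝ, E) y →ₗ[ℝ] S y →ₗ[ℝ] S y :=
    LinearMap.restrictScalarsₗ ℝ 𝕜 (S y) (S y) ℝ ∘ₗ σ.gammaLM y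
  have hframe : leibnizDefect nabla nablaS nablaS μ Z X ξ =
      leibnizDefect nabla nablaS nablaS μ Z (fun y => (s y).1 v) (fun y => (s y).2 ψ) :=
    leibnizDefect_congr nabla nablaS nablaS (fun _ _ => σ.mdifferentiableAt_gamma) Z hX
      (hs.mdifferentiableAt_fst hx v) hξ (hs.mdifferentiableAt_snd hx ψ) hv.symm hψ.symm
  have hzero : leibnizDefect nabla nablaS nablaS μ Z (fun y => (s y).1 v) (fun y => (s y).2 ψ) =
      0 := by
    rw [leibnizDefect, sub_sub]
    exact sub_eq_zero.2 (hs.nabla_gamma hx hnabla hnablaS v ψ Z)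
  rw [hzero, leibnizDefect, sub_sub] at hframe
  exact sub_eq_zero.1 hframe

end SpinStructure

end Parallel

/-! ### Homogeneous connections -/

section Homogeneous

variable {𝕜 : Type*} [RCLike 𝕜]
  {E : Type*} [NormedAddCommGroup E] [NormedSpace ℝ E]
  {M : Type*} [TopologicalSpace M] [ChartedSpace E M] [IsManifold 𝓘(ℝ, E) ∞ M]
  {F : Type*} [NormedAddCommGroup F] [NormedSpace ℝ F] [NormedSpace 𝕜 F] [IsScalarTower ℝ 𝕜 F]
  [FiniteDimensional 𝕜 F]
  {n : ℕ} {ε : Fin n → ℤˣ}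
  {S : M → Type*} [TopologicalSpace (Bundle.TotalSpace F S)]
  [∀ x, AddCommGroup (S x)] [∀ x, Module ℝ (S x)] [∀ x, Module 𝕜 (S x)]
  [∀ x, IsScalarTower ℝ 𝕜 (S x)] [∀ x, TopologicalSpace (S x)] [FiberBundle F S]
  {g : PseudoRiemannianMetric E M} {ρ : SpinorModule 𝕜 F ε}
  {A : Π x : M, TangentSpace 𝓘(ℝ, E) x →ₗ[ℝ] S x →ₗ[𝕜] S x} {ℓ : ℕ}

namespace SpinStructure

section Decomposition

variable {σ : SpinStructure (𝕜 := 𝕜) S g ρ}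
  {Fform : Π x : M, TangentSpace 𝓘(ℝ, E) x [⋀^Fin (ℓ + 1)]→ₗ[ℝ] 𝕜}
  {Gform : Π x : M, TangentSpace 𝓘(ℝ, E) x [⋀^Fin (ℓ - 1)]→ₗ[ℝ] 𝕜}
  {α A₀ : Π x : M, TangentSpace 𝓘(ℝ, E) x →ₗ[ℝ] TangentSpace 𝓘(ℝ, E) x [⋀^Fin ℓ]→ₗ[ℝ] 𝕜}

theorem IsHomogeneous.exists_linearMap (hhom : σ.IsHomogeneous A ℓ) (x : M) :
    ∃ α : TangentSpace 𝓘(ℝ, E) x →ₗ[ℝ] TangentSpace 𝓘(ℝ, E) x [⋀^Fin ℓ]→ₗ[ℝ] 𝕜,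
      ∀ X, A x X = σ.ofForm x (α X) := by
  choose w hw using hhom x
  refine ⟨⟨⟨w, fun X Y => σ.ofForm_injective x ?_⟩, fun r X => σ.ofForm_injective x ?_⟩, hw⟩
  · rw [← hw, map_add, hw, hw, ofForm_eq, ofForm_eq, ofForm_eq, map_add]
  · rw [← hw, map_smul, hw, ofForm_eq, ofForm_eq, map_smul, RingHom.id_apply]

theorem isDecomposition_iff (hα : ∀ x X, A x X = σ.ofForm x (α x X)) :
    σ.IsDecomposition A ℓ Fform Gform A₀ ↔
      ∀ x, IsFormDecomposition ε (σ.e x) (metric g x) (α x) (Fform x) (Gform x) (A₀ x) := by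
  refine ⟨fun h x => ⟨fun h0 => congrFun (h.lower_eq_zero h0) x, h.alternation_eq_zero x,
    h.trace_eq_zero x, LinearMap.ext fun X => σ.ofForm_injective x ?_⟩, fun h => ⟨fun h0 =>
    funext fun x => (h x).lower_eq_zero h0, fun x => (h x).alternation_eq_zero, fun x =>
    (h x).trace_eq_zero, fun x X => ?_⟩⟩
  · rw [← hα, h.eq]
    simp [wedgeLM_apply]
  · rw [hα, (h x).eq]
    simp [wedgeLM_apply]

theorem existsUnique_isDecomposition (hℓ : ℓ ≠ n + 1) (hhom : σ.IsHomogeneous A ℓ) :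
    ∃! FGA : (Π x : M, TangentSpace 𝓘(ℝ, E) x [⋀^Fin (ℓ + 1)]→ₗ[ℝ] 𝕜) ×
        (Π x : M, TangentSpace 𝓘(ℝ, E) x [⋀^Fin (ℓ - 1)]→ₗ[ℝ] 𝕜) ×
        (Π x : M, TangentSpace 𝓘(ℝ, E) x →ₗ[ℝ] TangentSpace 𝓘(ℝ, E) x [⋀^Fin ℓ]→ₗ[ℝ] 𝕜),
      σ.IsDecomposition A ℓ FGA.1 FGA.2.1 FGA.2.2 := by
  choose α hα using hhom.exists_linearMap
  choose F G A₀ hd using fun x =>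
    (σ.isOrthonormalFrame_e x).exists_isFormDecomposition (𝕜 := 𝕜) hℓ (α x)
  refine ⟨(F, G, A₀), (isDecomposition_iff hα).2 hd, ?_⟩
  rintro ⟨F', G', A₀'⟩ h
  have huniq (x : M) := IsFormDecomposition.unique (σ.isOrthonormalFrame_e x) hℓ
    ((isDecomposition_iff hα).1 h x) (hd x)
  exact Prod.ext (funext fun x => (huniq x).1)
    (Prod.ext (funext fun x => (huniq x).2.1) (funext fun x => (huniq x).2.2))

end Decomposition

section Admissible

variable (σ : SpinStructure (𝕜 := 𝕜) S g ρ) [FiniteDimensional ℝ E] [VectorBundle ℝ F S]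
  [ContMDiffVectorBundle ∞ F S 𝓘(ℝ, E)] [∀ x, IsTopologicalAddGroup (S x)]
  [∀ x, ContinuousSMul ℝ (S x)] {C : ChargeConjugation ρ}
  {nabla : CovariantDerivative 𝓘(ℝ, E) E (TangentSpace 𝓘(ℝ, E) : M → Type _)}
  {nablaS D : CovariantDerivative 𝓘(ℝ, E) F S}

theorem hatDGamma_eq (hnabla : IsMetricConnection g nabla)
    (hnablaS : σ.IsSpinLeviCivita nabla nablaS) (hA : IsDifference D nablaS A) {x : M}
    (Z : Π y : M, TangentSpace 𝓘(ℝ, E) y) {X : Π y : M, TangentSpace 𝓘(ℝ, E) y} {ξ : Π y : M, S y}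
    (hX : MDiffAt (T% X) x) (hξ : MDiffAt (T% ξ) x) :
    σ.hatDGamma C nabla nablaS D A Z X ξ x =
      (A x (Z x) * σ.gammaLM x (X x) + σ.gammaLM x (X x) * σ.adjoint C x (A x (Z x))) (ξ x) := by
  have hdiff := hA x (fun y => σ.gamma y (X y) (ξ y)) (Z x) (σ.mdifferentiableAt_gamma hX hξ)
  rw [σ.nabla_gamma hnabla hnablaS hX hξ, eq_sub_iff_add_eq] at hdiff
  simp only [hatDGamma, conjConnection, ← hdiff, map_sub, LinearMap.add_apply,
    Module.End.mul_apply, gammaLM_apply]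
  abel

theorem isAdmissible_iff (hnabla : IsMetricConnection g nabla)
    (hnablaS : σ.IsSpinLeviCivita nabla nablaS) (hA : IsDifference D nablaS A) :
    σ.IsAdmissible C nabla nablaS D A ↔
      ∀ x Z, A x Z * σ.gammaLM x Z + σ.gammaLM x Z * σ.adjoint C x (A x Z) = 0 := by
  constructor
  · intro h x Z
    have : IsAddTorsionFree (S x) := .of_isTorsionFree ℝ (S x)
    obtain ⟨U, s, hx, hs⟩ := σ.exists_isSpinFrame x
    obtain ⟨v, rfl⟩ := (s x).1.surjective Z
    ext ξ
    obtain ⟨ψ, rfl⟩ := (s x).2.surjective ξ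
    have hv := hs.mdifferentiableAt_fst hx v
    have hψ := hs.mdifferentiableAt_snd hx ψ
    have hskew := h x _ _ _ hv hv hψ
    rw [σ.hatDGamma_eq hnabla hnablaS hA _ hv hψ] at hskew
    exact self_eq_neg.1 hskew
  · intro h x Z X ξ hZ hX hξ
    let q (Z X : TangentSpace 𝓘(ℝ, E) x) : Module.End 𝕜 (S x) :=
      A x Z * σ.gammaLM x X + σ.gammaLM x X * σ.adjoint C x (A x Z)
    have hq : q (Z x + X x) (Z x + X x) =
        q (Z x) (Z x) + (q (Z x) (X x) + q (X x) (Z x)) + q (X x) (X x) := by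
      simp only [q, map_add, adjoint_add, mul_add, add_mul]
      abel
    have hdiag (Y : TangentSpace 𝓘(ℝ, E) x) : q Y Y = 0 := h x Y
    rw [hdiag, hdiag, hdiag, zero_add, add_zero] at hq
    rw [σ.hatDGamma_eq hnabla hnablaS hA Z hX hξ, σ.hatDGamma_eq hnabla hnablaS hA X hZ hξ,
      eq_neg_iff_add_eq_zero, ← LinearMap.add_apply]
    exact LinearMap.congr_fun hq.symm (ξ x)

end Admissible

end SpinStructure

end Homogeneous

end SpinGeometry

end

open SpinGeometry in
theorem theorem4p4_general {𝕜 : Type*} [RCLike 𝕜]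
    {E : Type*} [NormedAddCommGroup E] [NormedSpace ℝ E] [FiniteDimensional ℝ E]
    {M : Type*} [TopologicalSpace M] [ChartedSpace E M] [IsManifold 𝓘(ℝ, E) ∞ M]
    {F : Type*} [NormedAddCommGroup F] [NormedSpace ℝ F] [NormedSpace 𝕜 F] [IsScalarTower ℝ 𝕜 F]
    [FiniteDimensional 𝕜 F]
    {S : M → Type*} [TopologicalSpace (Bundle.TotalSpace F S)]
    [∀ x, AddCommGroup (S x)] [∀ x, Module ℝ (S x)] [∀ x, Module 𝕜 (S x)]
    [∀ x, IsScalarTower ℝ 𝕜 (S x)] [∀ x, TopologicalSpace (S x)]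
    [∀ x, IsTopologicalAddGroup (S x)] [∀ x, ContinuousSMul ℝ (S x)]
    [FiberBundle F S] [VectorBundle ℝ F S] [ContMDiffVectorBundle ∞ F S 𝓘(ℝ, E)]
    {n : ℕ} {ε : Fin n → ℤˣ}
    (g : SpinGeometry.PseudoRiemannianMetric E M)
    (ρ : SpinGeometry.SpinorModule 𝕜 F ε) (C : SpinGeometry.ChargeConjugation ρ)
    (σ : SpinGeometry.SpinStructure (𝕜 := 𝕜) S g ρ)
    (nabla : CovariantDerivative 𝓘(ℝ, E) E (TangentSpace 𝓘(ℝ, E) : M → Type _))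
    (hnabla : SpinGeometry.IsMetricConnection g nabla)
    (nablaS : CovariantDerivative 𝓘(ℝ, E) F S) (hnablaS : σ.IsSpinLeviCivita nabla nablaS)
    (D : CovariantDerivative 𝓘(ℝ, E) F S)
    (A : Π x : M, TangentSpace 𝓘(ℝ, E) x →ₗ[ℝ] S x →ₗ[𝕜] S x)
    (hA : SpinGeometry.SpinStructure.IsDifference D nablaS A)
    (ℓ : ℕ) (hℓ : ℓ ≠ n + 1) (hhom : σ.IsHomogeneous A ℓ) :
    (∃! FGA : (Π x : M, TangentSpace 𝓘(ℝ, E) x [⋀^Fin (ℓ + 1)]→ₗ[ℝ] 𝕜) ×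
        (Π x : M, TangentSpace 𝓘(ℝ, E) x [⋀^Fin (ℓ - 1)]→ₗ[ℝ] 𝕜) ×
        (Π x : M, TangentSpace 𝓘(ℝ, E) x →ₗ[ℝ] TangentSpace 𝓘(ℝ, E) x [⋀^Fin ℓ]→ₗ[ℝ] 𝕜),
      σ.IsDecomposition A ℓ FGA.1 FGA.2.1 FGA.2.2) ∧
    (∀ (Fform : Π x : M, TangentSpace 𝓘(ℝ, E) x [⋀^Fin (ℓ + 1)]→ₗ[ℝ] 𝕜)
        (Gform : Π x : M, TangentSpace 𝓘(ℝ, E) x [⋀^Fin (ℓ - 1)]→ₗ[ℝ] 𝕜)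
        (A₀ : Π x : M, TangentSpace 𝓘(ℝ, E) x →ₗ[ℝ] TangentSpace 𝓘(ℝ, E) x [⋀^Fin ℓ]→ₗ[ℝ] 𝕜),
      σ.IsDecomposition A ℓ Fform Gform A₀ →
      (σ.IsAdmissible C nabla nablaS D A ↔
        A₀ = 0 ∧ (Fform ≠ 0 → C.Δ 1 * C.Δ ((ℓ : ℤ) + 1) = -1) ∧
          (Gform ≠ 0 → C.Δ 1 * C.Δ ((ℓ : ℤ) - 1) = -1))) ∧
    (∀ deg : ℤ,
      (C.Δ 1 * C.Δ deg = -1 ↔ C.Δ 0 * C.Δ (deg - 1) = (-1) ^ deg) ∧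
      (C.Δ 1 * C.Δ deg = -1 ↔
        deg ≡ 3 [ZMOD 4] ∨ deg ≡ 1 + ((C.Δ 0 * C.Δ 1 : ℤˣ) : ℤ) [ZMOD 4])) := by
  refine ⟨SpinStructure.existsUnique_isDecomposition hℓ hhom, fun Fform Gform A₀ hdec => ?_,
    fun deg => ⟨Delta_one_mul_eq_neg_one_iff _ _ _, Delta_one_mul_eq_neg_one_iff_modEq _ _ _⟩⟩
  choose α hα using hhom.exists_linearMap
  have hpt (x : M) := by
    have := σ.nontrivial_fiber x
    exact (σ.isCliffordMap_gammaLM x).forall_cliffordLM_mul_add_eq_zero_iff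
      (σ.isOrthonormalFrame_e x) hℓ ((SpinStructure.isDecomposition_iff hα).1 hdec x)
      (C.Δ₀ * C.Δ ℓ)
  simp only [σ.isAdmissible_iff hnabla hnablaS hA, hα, σ.adjoint_ofForm, mul_smul_comm]
  simp only [SpinStructure.ofForm_eq, hpt, forall_and]
  rw [funext_iff, Function.ne_iff, Function.ne_iff]
  simp only [forall_exists_index, ChargeConjugation.Δ,
    Delta_one_mul_Delta_add_one_eq_neg_one_iff, Delta_one_mul_Delta_sub_one_eq_neg_one_iff]
  rfl

theorem theorem4p4 {𝕜 : Type*} [RCLike 𝕜]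
    {E : Type*} [NormedAddCommGroup E] [NormedSpace ℝ E] [FiniteDimensional ℝ E]
    {M : Type*} [TopologicalSpace M] [ChartedSpace E M] [IsManifold 𝓘(ℝ, E) ∞ M]
    {F : Type*} [NormedAddCommGroup F] [NormedSpace ℝ F] [NormedSpace 𝕜 F] [IsScalarTower ℝ 𝕜 F]
    [FiniteDimensional 𝕜 F]
    {S : M → Type*} [TopologicalSpace (Bundle.TotalSpace F S)]
    [∀ x, AddCommGroup (S x)] [∀ x, Module ℝ (S x)] [∀ x, Module 𝕜 (S x)]
    [∀ x, IsScalarTower ℝ 𝕜 (S x)] [∀ x, TopologicalSpace (S x)]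
    [∀ x, IsTopologicalAddGroup (S x)] [∀ x, ContinuousSMul ℝ (S x)]
    [FiberBundle F S] [VectorBundle ℝ F S] [ContMDiffVectorBundle ∞ F S 𝓘(ℝ, E)]
    {n : ℕ} {ε : Fin n → ℤˣ}
    (g : SpinGeometry.PseudoRiemannianMetric E M)
    (ρ : SpinGeometry.SpinorModule 𝕜 F ε) (C : SpinGeometry.ChargeConjugation ρ)
    (σ : SpinGeometry.SpinStructure (𝕜 := 𝕜) S g ρ)
    (nabla : CovariantDerivative 𝓘(ℝ, E) E (TangentSpace 𝓘(ℝ, E) : M → Type _))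
    (hnabla : SpinGeometry.IsLeviCivita g nabla)
    (nablaS : CovariantDerivative 𝓘(ℝ, E) F S) (hnablaS : σ.IsSpinLeviCivita nabla nablaS)
    (D : CovariantDerivative 𝓘(ℝ, E) F S)
    (A : Π x : M, TangentSpace 𝓘(ℝ, E) x →ₗ[ℝ] S x →ₗ[𝕜] S x)
    (hA : SpinGeometry.SpinStructure.IsDifference D nablaS A)
    (ℓ : ℕ) (hℓ : ℓ ≤ n) (hhom : σ.IsHomogeneous A ℓ) :
    -- the decomposition exists and is unique
    (∃! FGA : (Π x : M, TangentSpace 𝓘(ℝ, E) x [⋀^Fin (ℓ + 1)]→ₗ[ℝ] 𝕜) ×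
        (Π x : M, TangentSpace 𝓘(ℝ, E) x [⋀^Fin (ℓ - 1)]→ₗ[ℝ] 𝕜) ×
        (Π x : M, TangentSpace 𝓘(ℝ, E) x →ₗ[ℝ] TangentSpace 𝓘(ℝ, E) x [⋀^Fin ℓ]→ₗ[ℝ] 𝕜),
      σ.IsDecomposition A ℓ FGA.1 FGA.2.1 FGA.2.2) ∧
    -- the characterization of admissibility
    (∀ (Fform : Π x : M, TangentSpace 𝓘(ℝ, E) x [⋀^Fin (ℓ + 1)]→ₗ[ℝ] 𝕜)
        (Gform : Π x : M, TangentSpace 𝓘(ℝ, E) x [⋀^Fin (ℓ - 1)]→ₗ[ℝ] 𝕜)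
        (A₀ : Π x : M, TangentSpace 𝓘(ℝ, E) x →ₗ[ℝ] TangentSpace 𝓘(ℝ, E) x [⋀^Fin ℓ]→ₗ[ℝ] 𝕜),
      σ.IsDecomposition A ℓ Fform Gform A₀ →
      (σ.IsAdmissible C nabla nablaS D A ↔
        A₀ = 0 ∧ (Fform ≠ 0 → C.Δ 1 * C.Δ ((ℓ : ℤ) + 1) = -1) ∧
          (Gform ≠ 0 → C.Δ 1 * C.Δ ((ℓ : ℤ) - 1) = -1))) ∧
    -- the equivalent forms of the condition on the degree
    (∀ deg : ℤ,
      (C.Δ 1 * C.Δ deg = -1 ↔ C.Δ 0 * C.Δ (deg - 1) = (-1) ^ deg) ∧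
      (C.Δ 1 * C.Δ deg = -1 ↔
        deg ≡ 3 [ZMOD 4] ∨ deg ≡ 1 + ((C.Δ 0 * C.Δ 1 : ℤˣ) : ℤ) [ZMOD 4])) := by
  exact theorem4p4_general g ρ C σ nabla hnabla.metric nablaS hnablaS D A hA ℓ (by omega) hhom
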